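/- Let $(\cdot,\cdot)$ be the inner product of $L_2(\mathbb{R})$, linear in the second argument, and let $q\in L_2(\mathbb{R})$. For $f\in W_2^2(\mathbb{R}\setminus\{0\})$ put $f_r(0)=\tfrac12(f(0+)+f(0-))$, $f_s(0)=f(0+)-f(0-)$ and $f_s'(0)=f'(0+)-f'(0-)$. For $a\in\mathbb{C}$ let $H_a$ be the operator in $L_2(\mathbb{R})$ $$H_af=-f''+f_r(0)\,q,\qquad \mathcal{D}(H_a)=\{f\in W_2^2(\mathbb{R}\setminus\{0\}) : f_s(0)=0,\ f_s'(0)=a f_r(0)+(q,f)\},$$ where $f''$ is the derivative on $\mathbb{R}\setminus\{0\}$. For $\lambda\in\mathbb{C}\setminus[0,\infty)$ write $\lambda=k^2$ with $\operatorname{Im}k>0$, let $G(x)=\frac{i}{2k}e^{ik|x|}$ and let $$\widetilde W_\lambda=(q,G*q)+2ik\,[1+(G*q)(0)]\,[1+(G*q^*)(0)]$$ be the Weyl–Titchmarsh function ($^*$ denotes complex conjugation). A number $\lambda_0>0$ is called a spectral singularity of $H_a$ if there is $f\in L_2(\mathbb{R})$ such that the estimate $$\|(H_a-\lambda I)^{-1}f\|\le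 \frac{C}{|\operatorname{Im}\lambda|}\,\|f\|$$ fails as non-real $\lambda\to\lambda_0$, that is, for no constant $C$ and no neighbourhood $U$ of $\lambda_0$ does it hold for all non-real $\lambda\in U$ in the resolvent set of $H_a$. **Theorem.** Let $\lambda_0\in(0,\infty)$ and let $(\lambda_n)$ be a sequence of non-real numbers such that $\lambda_n\to\lambda_0$ and $\lim_{n\to\infty}\widetilde W_{\lambda_n}=a\in\mathbb{C}\setminus\mathbb{R}$. Then the operators $H_a$ and $H_{a^*}$ are not self-adjoint, and $\lambda_0$ is a spectral singularity of both $H_a$ and $H_{a^*}$. -/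

import Mathlib

open MeasureTheory Filter Topology
open scoped ContDiff ComplexConjugate

namespace NonlocalDelta

/-- The Hilbert space `L₂(ℝ)` of complex functions. Its inner product `inner ℂ f g = ∫ f̄ g` is
linear in the second argument. -/
abbrev L2 : Type := Lp ℂ 2 (volume : Measure ℝ)

/-- `g` is the weak (distributional) derivative of `f` on `ℝ \ {0}`: test functions are smooth with
compact support contained in `ℝ \ {0}`. -/
def IsWeakDeriv (f g : L2) : Prop :=
  ∀ φ : ℝ → ℝ, ContDiff ℝ ∞ φ → HasCompactSupport φ → tsupport φ ⊆ {0}ᶜ →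
    ∫ x, deriv φ x • f x = -∫ x, φ x • g x

/-- `c` is the boundary value `f(0+)`: the limit of `f(x)` as `x → 0`, `x > 0`, up to null sets
(equivalently, the limit at `0+` of the continuous representative, if `f` has one on `(0, ∞)`). -/
def HasRightLimit (f : L2) (c : ℂ) : Prop :=
  Tendsto f (𝓝[>] 0 ⊓ ae (volume : Measure ℝ)) (𝓝 c)

/-- `c` is the boundary value `f(0-)`. -/
def HasLeftLimit (f : L2) (c : ℂ) : Prop :=
  Tendsto f (𝓝[<] 0 ⊓ ae (volume : Measure ℝ)) (𝓝 c)

/-- `f` belongs to the Sobolev space `W₂²(ℝ \ {0})`, has weak derivatives `f'`, `f''` in `L₂(ℝ)`,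
and `fR = f(0+)`, `fL = f(0-)`, `dR = f'(0+)`, `dL = f'(0-)`.
(The four one-sided limits exist for every `f ∈ W₂²(ℝ \ {0})`; and `f`
determines `f'`, `f''`, `fR`, `fL`, `dR`, `dL`.) -/
structure IsSobolev (f f' f'' : L2) (fR fL dR dL : ℂ) : Prop where
  deriv₁ : IsWeakDeriv f f'
  deriv₂ : IsWeakDeriv f' f''
  right : HasRightLimit f fR
  left : HasLeftLimit f fL
  derivRight : HasRightLimit f' dR
  derivLeft : HasLeftLimit f' dL

theorem integrable_test_smul {φ : ℝ → ℝ} (hφ : Continuous φ) (hc : HasCompactSupport φ) (f : L2) :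
    Integrable (fun x => φ x • f x) := by
  have hf : LocallyIntegrable (f : ℝ → ℂ) volume :=
    (Lp.memLp f).locallyIntegrable (by norm_num)
  exact hf.integrable_smul_left_of_hasCompactSupport hφ hc

theorem IsWeakDeriv.add {f g f' g' : L2} (hf : IsWeakDeriv f f') (hg : IsWeakDeriv g g') :
    IsWeakDeriv (f + g) (f' + g') := by
  intro φ h1 h2 h3
  have hd : Continuous (deriv φ) := h1.continuous_deriv (by simp)
  have e1 : ∫ x, deriv φ x • (f + g : L2) x =
      ∫ x, (deriv φ x • f x + deriv φ x • g x) := by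
    refine integral_congr_ae ?_
    filter_upwards [Lp.coeFn_add f g] with x hx
    rw [hx, Pi.add_apply, smul_add]
  have e2 : ∫ x, φ x • (f' + g' : L2) x = ∫ x, (φ x • f' x + φ x • g' x) := by
    refine integral_congr_ae ?_
    filter_upwards [Lp.coeFn_add f' g'] with x hx
    rw [hx, Pi.add_apply, smul_add]
  rw [e1, e2, integral_add (integrable_test_smul hd h2.deriv f)
    (integrable_test_smul hd h2.deriv g), integral_add (integrable_test_smul h1.continuous h2 f')
    (integrable_test_smul h1.continuous h2 g'), hf φ h1 h2 h3, hg φ h1 h2 h3]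
  ring

theorem IsWeakDeriv.smul {f f' : L2} (c : ℂ) (hf : IsWeakDeriv f f') :
    IsWeakDeriv (c • f) (c • f') := by
  intro φ h1 h2 h3
  have e1 : ∫ x, deriv φ x • (c • f : L2) x = ∫ x, c • (deriv φ x • f x) := by
    refine integral_congr_ae ?_
    filter_upwards [Lp.coeFn_smul c f] with x hx
    rw [hx, Pi.smul_apply, smul_comm]
  have e2 : ∫ x, φ x • (c • f' : L2) x = ∫ x, c • (φ x • f' x) := by
    refine integral_congr_ae ?_
    filter_upwards [Lp.coeFn_smul c f'] with x hx
    rw [hx, Pi.smul_apply, smul_comm]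
  rw [e1, e2, integral_smul, integral_smul, hf φ h1 h2 h3, smul_neg]

theorem IsWeakDeriv.eq_zero {g : L2} (h : IsWeakDeriv 0 g) : g = 0 := by
  have hg : LocallyIntegrable (g : ℝ → ℂ) volume :=
    (Lp.memLp g).locallyIntegrable (by norm_num)
  have key : ∀ᵐ x ∂(volume : Measure ℝ), x ∈ ({0}ᶜ : Set ℝ) → g x = 0 := by
    refine IsOpen.ae_eq_zero_of_integral_contDiff_smul_eq_zero isOpen_compl_singleton
      (hg.locallyIntegrableOn _) ?_
    intro φ h1 h2 h3
    have := h φ h1 h2 h3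
    have e : ∫ x, deriv φ x • (0 : L2) x = 0 := by
      rw [← integral_zero ℝ ℂ]
      refine integral_congr_ae ?_
      filter_upwards [Lp.coeFn_zero ℂ 2 (volume : Measure ℝ)] with x hx
      simp
    rw [e] at this
    exact neg_eq_zero.mp this.symm
  refine Lp.eq_zero_iff_ae_eq_zero.mpr ?_
  have h0 : ∀ᵐ x ∂(volume : Measure ℝ), x ≠ 0 := by
    simp [ae_iff]
  filter_upwards [key, h0] with x hx hx0
  exact hx hx0

theorem neBot_right : (𝓝[>] (0 : ℝ) ⊓ ae (volume : Measure ℝ)).NeBot := by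
  rw [inf_neBot_iff_frequently_left]
  intro p hp
  rw [frequently_ae_iff]
  obtain ⟨u, hu, hsub⟩ := mem_nhdsGT_iff_exists_Ioo_subset.mp hp
  have hu' : (0 : ℝ) < u := hu
  intro h0
  have := measure_mono_null hsub h0
  simp [Real.volume_Ioo] at this
  linarith

theorem neBot_left : (𝓝[<] (0 : ℝ) ⊓ ae (volume : Measure ℝ)).NeBot := by
  rw [inf_neBot_iff_frequently_left]
  intro p hp
  rw [frequently_ae_iff]
  obtain ⟨u, hu, hsub⟩ := mem_nhdsLT_iff_exists_Ioo_subset.mp hp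
  have hu' : u < (0 : ℝ) := hu
  intro h0
  have := measure_mono_null hsub h0
  simp [Real.volume_Ioo] at this
  linarith

theorem IsSobolev.add {f f' f'' g g' g'' : L2} {fR fL dR dL gR gL eR eL : ℂ}
    (hf : IsSobolev f f' f'' fR fL dR dL) (hg : IsSobolev g g' g'' gR gL eR eL) :
    IsSobolev (f + g) (f' + g') (f'' + g'') (fR + gR) (fL + gL) (dR + eR) (dL + eL) where
  deriv₁ := hf.deriv₁.add hg.deriv₁
  deriv₂ := hf.deriv₂.add hg.deriv₂
  right := (Tendsto.add hf.right hg.right).congr'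
    (Filter.EventuallyEq.symm ((Lp.coeFn_add f g).filter_mono inf_le_right))
  left := (Tendsto.add hf.left hg.left).congr'
    (Filter.EventuallyEq.symm ((Lp.coeFn_add f g).filter_mono inf_le_right))
  derivRight := (Tendsto.add hf.derivRight hg.derivRight).congr'
    (Filter.EventuallyEq.symm ((Lp.coeFn_add f' g').filter_mono inf_le_right))
  derivLeft := (Tendsto.add hf.derivLeft hg.derivLeft).congr'
    (Filter.EventuallyEq.symm ((Lp.coeFn_add f' g').filter_mono inf_le_right))

theorem IsSobolev.smul {f f' f'' : L2} {fR fL dR dL : ℂ} (c : ℂ)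
    (hf : IsSobolev f f' f'' fR fL dR dL) :
    IsSobolev (c • f) (c • f') (c • f'') (c * fR) (c * fL) (c * dR) (c * dL) where
  deriv₁ := hf.deriv₁.smul c
  deriv₂ := hf.deriv₂.smul c
  right := (Tendsto.const_smul hf.right c).congr'
    (Filter.EventuallyEq.symm ((Lp.coeFn_smul c f).filter_mono inf_le_right))
  left := (Tendsto.const_smul hf.left c).congr'
    (Filter.EventuallyEq.symm ((Lp.coeFn_smul c f).filter_mono inf_le_right))
  derivRight := (Tendsto.const_smul hf.derivRight c).congr'
    (Filter.EventuallyEq.symm ((Lp.coeFn_smul c f').filter_mono inf_le_right))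
  derivLeft := (Tendsto.const_smul hf.derivLeft c).congr'
    (Filter.EventuallyEq.symm ((Lp.coeFn_smul c f').filter_mono inf_le_right))

theorem isSobolev_zero : IsSobolev 0 0 0 0 0 0 0 := by
  have h0 : IsWeakDeriv 0 0 := by
    intro φ _ _ _
    have e : ∀ ψ : ℝ → ℝ, ∫ x, ψ x • (0 : L2) x = 0 := by
      intro ψ
      rw [← integral_zero ℝ ℂ]
      refine integral_congr_ae ?_
      filter_upwards [Lp.coeFn_zero ℂ 2 (volume : Measure ℝ)] with x hx
      simp
    rw [e, e, neg_zero]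
  have hl : ∀ l : Filter ℝ, Tendsto (0 : L2) (l ⊓ ae (volume : Measure ℝ)) (𝓝 0) := fun l =>
    tendsto_const_nhds.congr' (Filter.EventuallyEq.symm
      ((Lp.coeFn_zero ℂ 2 (volume : Measure ℝ)).filter_mono inf_le_right))
  exact ⟨h0, h0, hl _, hl _, hl _, hl _⟩

theorem IsSobolev.eq_zero {f' f'' : L2} {fR fL dR dL : ℂ}
    (h : IsSobolev 0 f' f'' fR fL dR dL) :
    f' = 0 ∧ f'' = 0 ∧ fR = 0 ∧ fL = 0 ∧ dR = 0 ∧ dL = 0 := by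
  have := neBot_right
  have := neBot_left
  obtain rfl := h.deriv₁.eq_zero
  obtain rfl := h.deriv₂.eq_zero
  exact ⟨rfl, rfl, tendsto_nhds_unique h.right isSobolev_zero.right,
    tendsto_nhds_unique h.left isSobolev_zero.left,
    tendsto_nhds_unique h.derivRight isSobolev_zero.derivRight,
    tendsto_nhds_unique h.derivLeft isSobolev_zero.derivLeft⟩

/-- The graph of `H_a`: the pairs `(f, -f'' + f_r(0) q)` with `f ∈ W₂²(ℝ \ {0})`,
`f_s(0) = 0` and `f_s'(0) = a f_r(0) + (q, f)`, where `f_r(0) = (f(0+) + f(0-)) / 2`,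
`f_s(0) = f(0+) - f(0-)` and `f_s'(0) = f'(0+) - f'(0-)`. -/
def deltaGraph (q : L2) (a : ℂ) : Submodule ℂ (L2 × L2) where
  carrier := {p | ∃ (f' f'' : L2) (fR fL dR dL : ℂ), IsSobolev p.1 f' f'' fR fL dR dL ∧
    fR - fL = 0 ∧
    dR - dL = a * ((fR + fL) / 2) + inner ℂ q p.1 ∧
    p.2 = -f'' + ((fR + fL) / 2) • q}
  add_mem' := by
    rintro p r ⟨f', f'', fR, fL, dR, dL, h, h1, h2, h3⟩ ⟨g', g'', gR, gL, eR, eL, k, k1, k2, k3⟩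
    refine ⟨_, _, _, _, _, _, h.add k, ?_, ?_, ?_⟩
    · linear_combination h1 + k1
    · rw [Prod.fst_add, inner_add_right]
      linear_combination h2 + k2
    · rw [Prod.snd_add, h3, k3]
      module
  zero_mem' := ⟨0, 0, 0, 0, 0, 0, isSobolev_zero, by simp, by simp, by simp⟩
  smul_mem' := by
    rintro c p ⟨f', f'', fR, fL, dR, dL, h, h1, h2, h3⟩
    refine ⟨_, _, _, _, _, _, h.smul c, ?_, ?_, ?_⟩
    · linear_combination c * h1
    · rw [Prod.smul_fst, inner_smul_right]
      linear_combination c * h2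
    · rw [Prod.smul_snd, h3]
      module

theorem deltaGraph_snd_eq_zero (q : L2) (a : ℂ) (p : L2 × L2) (hp : p ∈ deltaGraph q a)
    (hp1 : p.1 = 0) : p.2 = 0 := by
  obtain ⟨f', f'', fR, fL, dR, dL, h, -, -, h3⟩ := hp
  rw [hp1] at h
  obtain ⟨-, rfl, rfl, rfl, -, -⟩ := h.eq_zero
  simp [h3]

/-- The nonlocal `δ`-interaction operator `H_a f = -f'' + f_r(0) q` in `L₂(ℝ)`, with domain
`{f ∈ W₂²(ℝ \ {0}) : f_s(0) = 0, f_s'(0) = a f_r(0) + (q, f)}`. -/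
noncomputable def H (q : L2) (a : ℂ) : L2 →ₗ.[ℂ] L2 :=
  (deltaGraph q a).toLinearPMap

/-- The operator really has the graph by which it is defined. -/
theorem H_graph (q : L2) (a : ℂ) : (H q a).graph = deltaGraph q a :=
  Submodule.toLinearPMap_graph_eq _ (deltaGraph_snd_eq_zero q a)

/-- The square root `k = √lam` with `Im k > 0`, for `lam ∈ ℂ \ [0, ∞)`. -/
noncomputable def sqrtUpper (lam : ℂ) : ℂ := Complex.I * (-lam) ^ (1 / 2 : ℂ)

theorem sqrtUpper_sq (lam : ℂ) : sqrtUpper lam ^ 2 = lam := by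
  have h : ((-lam) ^ (1 / 2 : ℂ)) ^ 2 = -lam := by
    simp
  rw [sqrtUpper, mul_pow, h, Complex.I_sq]
  ring

theorem sqrtUpper_im_pos {lam : ℂ} (h : -lam ∈ Complex.slitPlane) : 0 < (sqrtUpper lam).im := by
  have h0 : -lam ≠ 0 := Complex.slitPlane_ne_zero h
  have harg : (-lam).arg ≠ Real.pi := (Complex.mem_slitPlane_iff_arg.mp h).1
  rw [sqrtUpper, Complex.I_mul_im, Complex.cpow_def_of_ne_zero h0, Complex.exp_re]
  have him : (Complex.log (-lam) * (1 / 2)).im = (-lam).arg / 2 := by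
    rw [mul_one_div, Complex.div_ofNat_im, Complex.log_im]
  rw [him]
  refine mul_pos (Real.exp_pos _) (Real.cos_pos_of_mem_Ioo ⟨?_, ?_⟩)
  · linarith [Complex.neg_pi_lt_arg (-lam)]
  · linarith [lt_of_le_of_ne (Complex.arg_le_pi (-lam)) harg]

/-- `G(x) = (i / 2k) exp(ik|x|)`. -/
noncomputable def G (k : ℂ) (x : ℝ) : ℂ :=
  Complex.I / (2 * k) * Complex.exp (Complex.I * k * (|x| : ℝ))

/-- The convolution `(G * p)(x) = ∫ G(x - s) p(s) ds`. -/
noncomputable def convG (k : ℂ) (p : ℝ → ℂ) (x : ℝ) : ℂ := ∫ s, G k (x - s) * p s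

/-- The Weyl–Titchmarsh function
`W̃_lam = (q, G * q) + 2ik [1 + (G * q)(0)] [1 + (G * q̄)(0)]`, `lam = k²`, `Im k > 0`. -/
noncomputable def weyl (q : L2) (lam : ℂ) : ℂ :=
  (∫ x, conj (q x) * convG (sqrtUpper lam) q x) +
    2 * Complex.I * sqrtUpper lam * (1 + convG (sqrtUpper lam) q 0) *
      (1 + convG (sqrtUpper lam) (fun x => conj (q x)) 0)

/-- `R` is the resolvent `(A - lam I)⁻¹`, an everywhere defined bounded operator on `L₂(ℝ)`
(so that `lam` belongs to the resolvent set of `A`). -/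
def IsResolventAt (A : L2 →ₗ.[ℂ] L2) (lam : ℂ) (R : L2 →L[ℂ] L2) : Prop :=
  (∀ f : L2, ∃ h : R f ∈ A.domain, A ⟨R f, h⟩ - lam • R f = f) ∧
    ∀ u : A.domain, R (A u - lam • (u : L2)) = u

/-- The positive number `lam₀` is a spectral singularity of `A`: for some `f ∈ L₂(ℝ)` there is no
constant `C` for which `‖(A - lam I)⁻¹ f‖ ≤ C / |Im lam| ‖f‖` for all non-real `lam` of the
resolvent set in some neighbourhood of `lam₀`. -/
def IsSpectralSingularity (A : L2 →ₗ.[ℂ] L2) (lam₀ : ℝ) : Prop :=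
  0 < lam₀ ∧ ∃ f : L2, ∀ C : ℝ, ∀ ε > 0, ∃ (lam : ℂ) (R : L2 →L[ℂ] L2),
    lam.im ≠ 0 ∧ ‖lam - lam₀‖ < ε ∧ IsResolventAt A lam R ∧ C / |lam.im| * ‖f‖ < ‖R f‖

end NonlocalDelta

namespace NonlocalDelta

/-! For `lam` off `[0, ∞)` there is an `L₂` solution `u_lam` of `-u'' + q = lam u` on `ℝ \ {0}` with
`u(0) = 1`, namely `[1 + (G * q)(0)] exp(ik|x|) - G * q`, and the Weyl–Titchmarsh function is the
defect `W(lam) = u_s'(0) - (q, u)` in its boundary condition. Hence `u_lam` is an eigenfunction of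
`H_a` exactly when `W(lam) = a`.

Green's identity gives `W(lam) - conj W(mu) = (lam - conj mu) (u_mu, u_lam)`. From this follow the
symmetry `W(conj lam) = conj W(lam)`, the formula `Im lam ‖u_lam‖² = Im W(lam)` and the holomorphy
of `W` (`IsWeylSolution.sub_conj`, `hasDerivAt_weyl`). It also yields Krein's formula `(H_a - lam)⁻¹
g = D g - (v, g) / (W(lam) - a) u_lam` with `v = u_{conj lam}`, where `D` is the Dirichlet resolvent
(`exists_resolvent`).

Applying the formula to `g = v`, and using `‖u_lam‖ = ‖v‖` and `|Im lam| ‖D‖ ≤ 1`, gives `|Im lam|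
‖(H_a - lam)⁻¹‖ ≥ |Im W(lam)| / |W(lam) - a| - 1`. If `W(lam_n) → a` with `a` not real, the right
side is unbounded, and the uniform boundedness principle supplies one `f` for which the resolvent
estimate fails. Points with `W(lam_n) = a` are eigenvalues and are first moved slightly, which is
possible because the holomorphic `W` is real at `-1` and so is not constantly `a`. Self-adjointness
would force the resolvent estimate with `C = 1`, and `conj a` is reached along `conj lam_n`. -/

/-! ### Primitives of locally integrable functions and integration by parts -/

theorem intervalIntegrable_of_locallyIntegrable {p : ℝ → ℂ} (hp : LocallyIntegrable p) (a b : ℝ) :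
    IntervalIntegrable p volume a b :=
  (hp.integrableOn_isCompact isCompact_uIcc).intervalIntegrable

theorem absolutelyContinuousOnInterval_const (c : ℂ) (a b : ℝ) :
    AbsolutelyContinuousOnInterval (fun _ : ℝ => c) a b :=
  (LipschitzWith.const c).lipschitzOnWith.absolutelyContinuousOnInterval

theorem absolutelyContinuousOnInterval_primitive {p : ℝ → ℂ} {a b : ℝ}
    (hp : IntervalIntegrable p volume a b) :
    AbsolutelyContinuousOnInterval (fun x => ∫ t in a..x, p t) a b := by
  have hre : IntervalIntegrable (fun t => (p t).re) volume a b := ⟨hp.1.re, hp.2.re⟩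
  have him : IntervalIntegrable (fun t => (p t).im) volume a b := ⟨hp.1.im, hp.2.im⟩
  have h1 := (hre.absolutelyContinuousOnInterval_intervalIntegral
    (c := a) Set.left_mem_uIcc).fun_smul (absolutelyContinuousOnInterval_const 1 a b)
  have h2 := (him.absolutelyContinuousOnInterval_intervalIntegral
    (c := a) Set.left_mem_uIcc).fun_smul (absolutelyContinuousOnInterval_const Complex.I a b)
  -- The primitive is recombined from its real and imaginary parts. The identity is known only on
  -- `uIcc a b`, which contains all the endpoints that absolute continuity tests.
  refine (h1.add h2).congr' ?_
  refine eventually_inf_principal.2 (Eventually.of_forall fun I hI => Finset.sum_congr rfl ?_)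
  have key : ∀ x ∈ Set.uIcc a b, ((∫ t in a..x, (p t).re) • (1 : ℂ) +
      (∫ t in a..x, (p t).im) • Complex.I) = ∫ t in a..x, p t := by
    intro x hx
    have hpx : IntervalIntegrable p volume a x :=
      hp.mono_set (Set.uIcc_subset_uIcc_left hx)
    apply Complex.ext
    · have := (Complex.reCLM.intervalIntegral_comp_comm hpx)
      simpa using this
    · have := (Complex.imCLM.intervalIntegral_comp_comm hpx)
      simpa using this
  intro i hi
  have hh := hI.1 i hi
  simp only [Pi.add_apply]
  rw [key _ hh.1, key _ hh.2]

/-- Integration by parts for primitives of locally integrable functions. -/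
theorem integral_primitive_mul {p r F K : ℝ → ℂ} (hp : LocallyIntegrable p)
    (hr : LocallyIntegrable r) {α β : ℂ} {a : ℝ} (hF : ∀ x, F x = α + ∫ t in a..x, p t)
    (hK : ∀ x, K x = β + ∫ t in a..x, r t) (b : ℝ) :
    ∫ x in a..b, (p x * K x + F x * r x) = F b * K b - α * β := by
  have hpi := intervalIntegrable_of_locallyIntegrable hp
  have hri := intervalIntegrable_of_locallyIntegrable hr
  have hFc : Continuous F := by
    rw [funext hF]
    exact continuous_const.add (intervalIntegral.continuous_primitive hpi a)
  have hKc : Continuous K := by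
    rw [funext hK]
    exact continuous_const.add (intervalIntegral.continuous_primitive hri a)
  have hFa : AbsolutelyContinuousOnInterval F a b := by
    rw [funext hF]
    exact (absolutelyContinuousOnInterval_const α a b).add
      (absolutelyContinuousOnInterval_primitive (hpi a b))
  have hKa : AbsolutelyContinuousOnInterval K a b := by
    rw [funext hK]
    exact (absolutelyContinuousOnInterval_const β a b).add
      (absolutelyContinuousOnInterval_primitive (hri a b))
  have hm : LocallyIntegrable (fun x => p x * K x + F x * r x) := by
    refine LocallyIntegrable.add ?_ ?_
    · exact (locallyIntegrableOn_univ.1 ((locallyIntegrableOn_univ.2 hp).mul_continuousOn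
        hKc.continuousOn isClosed_univ.isLocallyClosed))
    · exact (locallyIntegrableOn_univ.1 ((locallyIntegrableOn_univ.2 hr).continuousOn_mul
        hFc.continuousOn isClosed_univ.isLocallyClosed))
  have hmi := intervalIntegrable_of_locallyIntegrable hm a b
  -- The difference of `F K` and the primitive of its formal derivative is absolutely continuous
  -- with derivative zero almost everywhere, hence constant.
  have hac := (hFa.smul hKa).fun_sub (absolutelyContinuousOnInterval_primitive hmi)
  have hd : ∀ᵐ x, x ∈ Set.uIcc a b → HasDerivAt
      (fun x => (F • K) x - ∫ t in a..x, (p t * K t + F t * r t)) 0 x := by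
    filter_upwards [LocallyIntegrable.ae_hasDerivAt_integral hp, LocallyIntegrable.ae_hasDerivAt_integral hr,
      LocallyIntegrable.ae_hasDerivAt_integral hm] with x h1 h2 h3 _
    have e1 : HasDerivAt F (p x) x := by
      rw [funext hF]; exact (h1 a).const_add α
    have e2 : HasDerivAt K (r x) x := by
      rw [funext hK]; exact (h2 a).const_add β
    have := (e1.mul e2).sub (h3 a)
    rw [sub_self] at this
    exact this
  obtain ⟨C, hC⟩ := hac.const_of_ae_hasDerivAt_zero hd
  have ha := hC a Set.left_mem_uIcc
  have hb := hC b Set.right_mem_uIcc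
  have hFa' : F a = α := by simp [hF]
  have hKa' : K a = β := by simp [hK]
  simp only [Pi.smul_apply', smul_eq_mul, hFa', hKa', intervalIntegral.integral_same, sub_zero]
    at ha hb
  rw [ha]
  linear_combination -hb

theorem integral_eq_intervalIntegral_of_tsupport {φ : ℝ → ℝ} (hc : HasCompactSupport φ) :
    ∃ A B : ℝ, A < B ∧ φ A = 0 ∧ φ B = 0 ∧ ∀ g : ℝ → ℂ,
      (∫ x, φ x • g x = ∫ x in A..B, φ x • g x) ∧
      (∫ x, deriv φ x • g x = ∫ x in A..B, deriv φ x • g x) := by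
  obtain ⟨R, hR⟩ := hc.isBounded.subset_ball 0
  have hsub : tsupport φ ⊆ Set.Ioo (-(|R| + 1)) (|R| + 1) := fun x hx => by
    have h := hR hx
    rw [Metric.mem_ball, Real.dist_eq, sub_zero, abs_lt] at h
    have := le_abs_self R
    exact ⟨by linarith [h.1], by linarith [h.2]⟩
  have hpos := abs_nonneg R
  refine ⟨-(|R| + 1), |R| + 1, by linarith, ?_, ?_, fun g => ⟨?_, ?_⟩⟩
  · exact image_eq_zero_of_notMem_tsupport fun h => lt_irrefl _ (hsub h).1
  · exact image_eq_zero_of_notMem_tsupport fun h => lt_irrefl _ (hsub h).2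
  · refine (intervalIntegral.integral_eq_integral_of_support_subset fun x hx => ?_).symm
    refine Set.Ioo_subset_Ioc_self (hsub (subset_tsupport _ ?_))
    exact fun h => hx (by simp [h])
  · refine (intervalIntegral.integral_eq_integral_of_support_subset fun x hx => ?_).symm
    refine Set.Ioo_subset_Ioc_self (hsub (support_deriv_subset ?_))
    exact fun h => hx (by simp [h])

theorem integral_deriv_smul_primitive {p : ℝ → ℂ} (hp : LocallyIntegrable p) {φ : ℝ → ℝ}
    (hφ : ContDiff ℝ ∞ φ) (hc : HasCompactSupport φ) (c : ℝ) :
    ∫ x, deriv φ x • (∫ t in c..x, p t) = -∫ x, φ x • p x := by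
  obtain ⟨A, B, hAB, hA, hB, h⟩ := integral_eq_intervalIntegral_of_tsupport hc
  have hd : Continuous (deriv φ) := hφ.continuous_deriv (by simp)
  have hdc : Continuous fun x => ((deriv φ x : ℝ) : ℂ) := Complex.continuous_ofReal.comp hd
  have hpi := intervalIntegrable_of_locallyIntegrable hp
  have key := integral_primitive_mul (p := fun x => ((deriv φ x : ℝ) : ℂ)) (r := p)
    (F := fun x => (φ x : ℂ)) (K := fun x => ∫ t in c..x, p t) (α := 0) (β := ∫ t in c..A, p t)
    (a := A) hdc.locallyIntegrable hp ?_ ?_ B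
  · rw [(h _).1, (h _).2]
    simp only [Complex.real_smul]
    rw [intervalIntegral.integral_add] at key
    · simp only [hB, Complex.ofReal_zero, zero_mul, sub_zero] at key
      linear_combination key
    · exact (hdc.mul (intervalIntegral.continuous_primitive hpi c)).intervalIntegrable _ _
    · exact (hpi A B).continuousOn_mul
        (Complex.continuous_ofReal.comp hφ.continuous).continuousOn
  · intro x
    have := intervalIntegral.integral_deriv_eq_sub' (a := A) (b := x) φ rfl
      (fun y _ => (hφ.differentiable (by simp)).differentiableAt) hd.continuousOn
    rw [intervalIntegral.integral_ofReal, this, hA]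
    simp
  · intro x
    exact (intervalIntegral.integral_add_adjacent_intervals (hpi _ _) (hpi _ _)).symm

/-- The lemma of du Bois-Reymond: a function with zero weak derivative on an interval is
constant there. -/
theorem ae_const_of_integral_deriv_smul_eq_zero {f : ℝ → ℂ} (hf : LocallyIntegrable f)
    {U : Set ℝ} (hU : IsOpen U) (hord : U.OrdConnected) (hne : U.Nonempty)
    (h : ∀ φ : ℝ → ℝ, ContDiff ℝ ∞ φ → HasCompactSupport φ → tsupport φ ⊆ U →
      ∫ x, deriv φ x • f x = 0) :
    ∃ c : ℂ, ∀ᵐ x ∂(volume : Measure ℝ), x ∈ U → f x = c := by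
  obtain ⟨x₀, hx₀⟩ := hne
  obtain ⟨ε, hε, hball⟩ := Metric.isOpen_iff.1 hU x₀ hx₀
  let β : ContDiffBump x₀ := ⟨ε / 4, ε / 2, by linarith, by linarith⟩
  set η : ℝ → ℝ := β.normed volume with hη
  have hηs : ContDiff ℝ ∞ η := β.contDiff_normed (n := ⊤)
  have hηc : HasCompactSupport η := β.hasCompactSupport_normed
  have hηU : tsupport η ⊆ U := by
    rw [hη, β.tsupport_normed_eq]
    exact (Metric.closedBall_subset_ball (by change ε / 2 < ε; linarith)).trans hball
  have hη1 : ∫ x, η x = 1 := β.integral_normed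
  have hfi : ∀ {ψ : ℝ → ℝ}, ContDiff ℝ ∞ ψ → HasCompactSupport ψ →
      Integrable fun x => ψ x • f x := fun h1 h2 =>
    hf.integrable_smul_left_of_hasCompactSupport h1.continuous h2
  refine ⟨∫ x, η x • f x, ?_⟩
  have hg : LocallyIntegrable (fun x => f x - ∫ x, η x • f x) :=
    hf.sub (locallyIntegrable_const _)
  suffices H : ∀ᵐ x ∂(volume : Measure ℝ), x ∈ U → f x - ∫ x, η x • f x = 0 by
    filter_upwards [H] with x hx hxU using sub_eq_zero.1 (hx hxU)
  refine hU.ae_eq_zero_of_integral_contDiff_smul_eq_zero (hg.locallyIntegrableOn _) ?_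
  intro ψ hψ hψc hψU
  have hψi : Integrable ψ := hψ.continuous.integrable_of_hasCompactSupport hψc
  have hηi : Integrable η := hηs.continuous.integrable_of_hasCompactSupport hηc
  -- Removing the mean of `ψ` leaves `θ` with integral zero, so that the primitive of `θ` is again
  -- compactly supported and is an admissible test function.
  set J : ℝ := ∫ x, ψ x with hJ
  set θ : ℝ → ℝ := fun x => ψ x - J * η x with hθ
  have hθs : ContDiff ℝ ∞ θ := hψ.sub (contDiff_const.mul hηs)
  have hθi : Integrable θ := hψi.sub (hηi.const_mul J)
  have hθ0 : ∫ x, θ x = 0 := by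
    rw [hθ, integral_sub hψi (hηi.const_mul J), integral_const_mul, hη1, ← hJ]; ring
  set Kc : Set ℝ := tsupport ψ ∪ tsupport η with hKc
  have hKcomp : IsCompact Kc := hψc.isCompact.union hηc.isCompact
  have hKne : Kc.Nonempty := by
    refine ⟨x₀, Or.inr ?_⟩
    rw [hη, β.tsupport_normed_eq]
    exact Metric.mem_closedBall_self β.rOut_pos.le
  have hKU : Kc ⊆ U := Set.union_subset hψU hηU
  set A := sInf Kc
  set B := sSup Kc
  -- The primitive of `θ` may be nonzero between the two supports; order-connectedness keeps that
  -- gap inside `U`.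
  have hABU : Set.Icc A B ⊆ U := hord.out (hKU (hKcomp.sInf_mem hKne)) (hKU (hKcomp.sSup_mem hKne))
  have hKAB : Kc ⊆ Set.Icc A B := fun x hx =>
    ⟨csInf_le hKcomp.bddBelow hx, le_csSup hKcomp.bddAbove hx⟩
  have hθz : ∀ x, x ∉ Set.Icc A B → θ x = 0 := by
    intro x hx
    have h1 : ψ x = 0 := image_eq_zero_of_notMem_tsupport fun h => hx (hKAB (Or.inl h))
    have h2 : η x = 0 := image_eq_zero_of_notMem_tsupport fun h => hx (hKAB (Or.inr h))
    simp [hθ, h1, h2]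
  set φ : ℝ → ℝ := fun x => ∫ t in (A - 1)..x, θ t with hφ
  have hφd : ∀ x, HasDerivAt φ (θ x) x := fun x =>
    intervalIntegral.integral_hasDerivAt_right (hθs.continuous.intervalIntegrable _ _)
      (hθs.continuous.stronglyMeasurableAtFilter _ _) hθs.continuous.continuousAt
  have hφderiv : deriv φ = θ := funext fun x => (hφd x).deriv
  have hφs : ContDiff ℝ ∞ φ := by
    rw [contDiff_infty_iff_deriv, hφderiv]
    exact ⟨fun x => (hφd x).differentiableAt, hθs⟩
  have hφz : ∀ x, x ∉ Set.Icc A B → φ x = 0 := by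
    intro x hx
    rw [Set.mem_Icc, not_and_or, not_le, not_le] at hx
    rcases hx with hx | hx
    · rw [hφ]
      refine intervalIntegral.integral_zero_ae (Eventually.of_forall fun t ht => ?_)
      refine hθz t fun h => ?_
      rcases Set.mem_uIoc.1 ht with h' | h' <;> linarith [h.1, h'.2]
    · simp only [hφ]
      rw [intervalIntegral.integral_eq_integral_of_support_subset, hθ0]
      intro t ht
      have : t ∈ Set.Icc A B := by
        by_contra hcon
        exact ht (hθz t hcon)
      exact ⟨by linarith [this.1], by linarith [this.2]⟩
  have hφt : tsupport φ ⊆ Set.Icc A B := by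
    refine closure_minimal (fun x hx => ?_) isClosed_Icc
    by_contra hcon
    exact hx (hφz x hcon)
  have hφc : HasCompactSupport φ :=
    HasCompactSupport.of_support_subset_isCompact isCompact_Icc ((subset_tsupport φ).trans hφt)
  have h0 := h φ hφs hφc (hφt.trans hABU)
  rw [hφderiv] at h0
  have e1 : ∫ x, θ x • f x = (∫ x, ψ x • f x) - J • ∫ x, η x • f x := by
    rw [← integral_smul, ← integral_sub (hfi hψ hψc) (g := fun x => J • η x • f x)
      ((hfi hηs hηc).smul J)]
    refine integral_congr_ae (Eventually.of_forall fun x => ?_)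
    simp only [hθ, sub_smul, mul_smul]
  have e2 : ∫ x, ψ x • (f x - ∫ x, η x • f x) =
      (∫ x, ψ x • f x) - J • ∫ x, η x • f x := by
    simp only [smul_sub]
    rw [integral_sub (hfi hψ hψc) (hψi.smul_const _), integral_smul_const]
  rw [e2, ← e1, h0]

/-! ### Functions with a weak derivative on a half-line are primitives -/

theorem locallyIntegrable_coeFn (f : L2) : LocallyIntegrable (f : ℝ → ℂ) volume :=
  (Lp.memLp f).locallyIntegrable (by norm_num)

theorem continuous_primitive_coeFn (f : L2) : Continuous fun x => ∫ t in (0 : ℝ)..x, f t :=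
  intervalIntegral.continuous_primitive
    (intervalIntegrable_of_locallyIntegrable (locallyIntegrable_coeFn f)) 0

/-- The difference of `f` and the primitive of `f'` has zero weak derivative on `U`, hence is
constant there; the limit at `0` along `l` identifies the constant as `c`. The filter `l` lets one
proof serve both sides of `0`. -/
theorem IsWeakDeriv.ae_eq_on {f f' : L2} (h : IsWeakDeriv f f') {U : Set ℝ} (hU : IsOpen U)
    (hord : U.OrdConnected) (h0 : U ⊆ {0}ᶜ) {l : Filter ℝ} (hl : l ≤ 𝓝 0) (hUl : U ∈ l)
    [hne : (l ⊓ ae (volume : Measure ℝ)).NeBot] {c : ℂ}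
    (hc : Tendsto f (l ⊓ ae (volume : Measure ℝ)) (𝓝 c)) :
    ∀ᵐ x ∂(volume : Measure ℝ), x ∈ U → f x = c + ∫ t in (0 : ℝ)..x, f' t := by
  have hl' : l.NeBot := hne.mono inf_le_left
  have hcont := continuous_primitive_coeFn f'
  obtain ⟨b, hb⟩ := ae_const_of_integral_deriv_smul_eq_zero
    (f := fun x => f x - ∫ t in (0 : ℝ)..x, f' t)
    ((locallyIntegrable_coeFn f).sub hcont.locallyIntegrable)
    hU hord (hl'.nonempty_of_mem hUl) (by
      intro φ h1 h2 h3
      have hd : Continuous (deriv φ) := h1.continuous_deriv (by simp)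
      simp only [smul_sub]
      rw [integral_sub (integrable_test_smul hd h2.deriv f)
        (hcont.locallyIntegrable.integrable_smul_left_of_hasCompactSupport hd h2.deriv),
        integral_deriv_smul_primitive (locallyIntegrable_coeFn f') h1 h2,
        h φ h1 h2 (h3.trans h0), sub_self])
  have hlim : Tendsto (fun x => f x - ∫ t in (0 : ℝ)..x, f' t) (l ⊓ ae (volume : Measure ℝ))
      (𝓝 (c - 0)) := by
    refine hc.sub (Tendsto.mono_left ?_ (inf_le_left.trans hl))
    have := hcont.tendsto 0
    rwa [intervalIntegral.integral_same] at this
  have hbc : c = b := by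
    rw [sub_zero] at hlim
    refine tendsto_nhds_unique hlim (tendsto_const_nhds.congr' ?_)
    have h1 : ∀ᶠ x in l ⊓ ae (volume : Measure ℝ), x ∈ U := Filter.mem_inf_of_left hUl
    have h2 : ∀ᶠ x in l ⊓ ae (volume : Measure ℝ), x ∈ U →
      f x - ∫ t in (0 : ℝ)..x, f' t = b := hb.filter_mono inf_le_right
    filter_upwards [h1, h2] with x hx hx2 using (hx2 hx).symm
  filter_upwards [hb] with x hx hxU
  rw [hbc, ← hx hxU]; ring

theorem IsWeakDeriv.ae_eq_right {f f' : L2} (h : IsWeakDeriv f f') {c : ℂ}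
    (hc : HasRightLimit f c) :
    ∀ᵐ x ∂(volume : Measure ℝ), x ∈ Set.Ioi (0 : ℝ) → f x = c + ∫ t in (0 : ℝ)..x, f' t :=
  have := neBot_right
  h.ae_eq_on isOpen_Ioi Set.ordConnected_Ioi (fun _ hx => ne_of_gt hx) nhdsWithin_le_nhds
    self_mem_nhdsWithin hc

theorem IsWeakDeriv.ae_eq_left {f f' : L2} (h : IsWeakDeriv f f') {c : ℂ}
    (hc : HasLeftLimit f c) :
    ∀ᵐ x ∂(volume : Measure ℝ), x ∈ Set.Iio (0 : ℝ) → f x = c + ∫ t in (0 : ℝ)..x, f' t :=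
  have := neBot_left
  h.ae_eq_on isOpen_Iio Set.ordConnected_Iio (fun _ hx => ne_of_lt hx) nhdsWithin_le_nhds
    self_mem_nhdsWithin hc

/-! ### Green's identities on the punctured line -/

theorem locallyIntegrable_conj {p : ℝ → ℂ} (hp : LocallyIntegrable p) :
    LocallyIntegrable fun x => conj (p x) := fun x =>
  let ⟨s, hs, hi⟩ := hp x
  ⟨s, hs, (LinearIsometryEquiv.integrable_comp_iff (RCLike.conjLIE (K := ℂ))).2 hi⟩

theorem integrable_conj_mul (f g : L2) : Integrable fun x => conj (g x) * f x := by
  have := L2.integrable_inner (𝕜 := ℂ) g f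
  refine this.congr (Eventually.of_forall fun x => ?_)
  simp [mul_comm]

theorem inner_eq_integral (f g : L2) : inner ℂ g f = ∫ x, conj (g x) * f x := by
  rw [L2.inner_def]
  refine integral_congr_ae (Eventually.of_forall fun x => ?_)
  simp [mul_comm]

theorem intervalIntegral_conj (p : ℝ → ℂ) (a b : ℝ) :
    ∫ t in a..b, conj (p t) = conj (∫ t in a..b, p t) := by
  simp only [intervalIntegral, integral_conj, map_sub]

/-- Integration by parts on a half-line `U` with endpoint `0`, for `L₂` functions with `L₂` weak
derivatives. -/
theorem tendsto_primitive_mul {f f' g g' : L2} {c b : ℂ} {U : Set ℝ}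
    (hf : ∀ᵐ x ∂(volume : Measure ℝ), x ∈ U → f x = c + ∫ t in (0 : ℝ)..x, f' t)
    (hg : ∀ᵐ x ∂(volume : Measure ℝ), x ∈ U → g x = b + ∫ t in (0 : ℝ)..x, g' t)
    {l : Filter ℝ} {J : ℂ} (hU : ∀ᶠ n in l, Set.uIoc 0 n ⊆ U ∪ {0}) (hUm : MeasurableSet U)
    (hl : IntegrableAtFilter (fun x => (conj (g x) * f x)) l)
    (hUl : U ∈ l) (hinf : ∀ s ∈ l, (volume : Measure ℝ) s = ⊤)
    (hJ : Tendsto (fun n => ∫ x in (0 : ℝ)..n, (conj (g' x) * f x + conj (g x) * f' x)) l (𝓝 J)) :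
    J = -(conj b * c) := by
  set F : ℝ → ℂ := fun x => c + ∫ t in (0 : ℝ)..x, f' t with hF
  set K : ℝ → ℂ := fun x => conj (b + ∫ t in (0 : ℝ)..x, g' t) with hK
  have hK' : ∀ x, K x = conj b + ∫ t in (0 : ℝ)..x, conj (g' t) := by
    intro x; rw [intervalIntegral_conj, ← map_add]
  have h0 : ∀ᵐ x ∂(volume : Measure ℝ), x ≠ 0 := by simp [ae_iff]
  have key : ∀ᶠ n in l, ∫ x in (0 : ℝ)..n, (conj (g' x) * f x + conj (g x) * f' x) =
      K n * F n - conj b * c := by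
    filter_upwards [hU] with n hn
    rw [← integral_primitive_mul (locallyIntegrable_conj (locallyIntegrable_coeFn g'))
      (locallyIntegrable_coeFn f') hK' (fun x => rfl) n]
    refine intervalIntegral.integral_congr_ae ?_
    filter_upwards [hf, hg, h0] with x h1 h2 h3 hx
    -- On the left half-line the interval `(n, 0]` contains the point `0`, which is discarded as a
    -- null set.
    have hxU : x ∈ U := (hn hx).resolve_right h3
    rw [h1 hxU, h2 hxU]
  have hlim : Tendsto (fun n => K n * F n) l (𝓝 (J + conj b * c)) := by
    refine ((hJ.congr' key).add_const (conj b * c)).congr fun n => ?_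
    ring
  -- The boundary term at infinity has a limit, and it is integrable near infinity as a product of
  -- `L₂` functions. Since sets in `l` have infinite measure, the limit is zero.
  have hint : IntegrableAtFilter (fun n => K n * F n) l := by
    obtain ⟨s, hs, hi⟩ := hl
    refine ⟨s ∩ U, inter_mem hs hUl, (hi.mono_set Set.inter_subset_left).congr ?_⟩
    have : ∀ᵐ x ∂(volume.restrict (s ∩ U)), x ∈ U :=
      (ae_mono (Measure.restrict_mono Set.inter_subset_right le_rfl))
        (ae_restrict_mem hUm)
    filter_upwards [this, ae_restrict_of_ae hf, ae_restrict_of_ae hg] with x hx h1 h2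
    rw [h1 hx, h2 hx]
  have := hint.eq_zero_of_tendsto hinf hlim
  linear_combination this

/-- Integration by parts for weakly differentiable functions on `ℝ \ {0}`. -/
theorem IsWeakDeriv.inner_add_inner {f f' g g' : L2} (hf : IsWeakDeriv f f')
    (hg : IsWeakDeriv g g') {fR fL gR gL : ℂ} (hfR : HasRightLimit f fR) (hfL : HasLeftLimit f fL)
    (hgR : HasRightLimit g gR) (hgL : HasLeftLimit g gL) :
    inner ℂ g' f + inner ℂ g f' = conj gL * fL - conj gR * fR := by
  have hint : Integrable fun x => conj (g' x) * f x + conj (g x) * f' x :=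
    (integrable_conj_mul f g').add (integrable_conj_mul f' g)
  have hR := tendsto_primitive_mul (hf.ae_eq_right hfR) (hg.ae_eq_right hgR) (l := atTop)
    (by
      filter_upwards [eventually_gt_atTop 0] with n hn x hx
      rw [Set.uIoc_of_le hn.le] at hx
      exact Or.inl hx.1) measurableSet_Ioi
    ((integrable_conj_mul f g).integrableAtFilter _) (Ioi_mem_atTop 0)
    (fun s hs => by
      obtain ⟨a, ha⟩ := mem_atTop_sets.1 hs
      exact top_unique (le_trans (by simp) (measure_mono (show Set.Ici a ⊆ s from ha))))
    (intervalIntegral_tendsto_integral_Ioi 0 hint.integrableOn tendsto_id)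
  have hL := tendsto_primitive_mul (hf.ae_eq_left hfL) (hg.ae_eq_left hgL) (l := atBot)
    (J := -∫ x in Set.Iic 0, (conj (g' x) * f x + conj (g x) * f' x))
    (by
      filter_upwards [eventually_lt_atBot 0] with n hn x hx
      rw [Set.uIoc_of_ge hn.le] at hx
      exact hx.2.lt_or_eq) measurableSet_Iio
    ((integrable_conj_mul f g).integrableAtFilter _) (Iio_mem_atBot 0)
    (fun s hs => by
      obtain ⟨a, ha⟩ := mem_atBot_sets.1 hs
      exact top_unique (le_trans (by simp) (measure_mono (show Set.Iic a ⊆ s from ha))))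
    (by
      have := (intervalIntegral_tendsto_integral_Iic 0 hint.integrableOn tendsto_id).neg
      refine this.congr fun n => ?_
      rw [intervalIntegral.integral_symm, neg_neg]; rfl)
  rw [inner_eq_integral, inner_eq_integral, ← integral_add (integrable_conj_mul f g')
    (integrable_conj_mul f' g), ← intervalIntegral.integral_Iic_add_Ioi (b := 0)
    hint.integrableOn hint.integrableOn]
  linear_combination hR - hL

/-- Green's first identity. -/
theorem IsSobolev.inner_second {f f' f'' g g' g'' : L2} {fR fL dR dL gR gL eR eL : ℂ}
    (hf : IsSobolev f f' f'' fR fL dR dL) (hg : IsSobolev g g' g'' gR gL eR eL) :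
    inner ℂ g f'' = -inner ℂ g' f' + conj gL * dL - conj gR * dR := by
  have := hf.deriv₂.inner_add_inner hg.deriv₁ hf.derivRight hf.derivLeft hg.right hg.left
  linear_combination this

/-- Green's second identity. -/
theorem IsSobolev.green {f f' f'' g g' g'' : L2} {fR fL dR dL gR gL eR eL : ℂ}
    (hf : IsSobolev f f' f'' fR fL dR dL) (hg : IsSobolev g g' g'' gR gL eR eL) :
    inner ℂ g f'' - inner ℂ g'' f =
      (conj gL * dL - conj gR * dR) - (conj eL * fL - conj eR * fR) := by
  have h1 := hf.deriv₂.inner_add_inner hg.deriv₁ hf.derivRight hf.derivLeft hg.right hg.left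
  have h2 := hf.deriv₁.inner_add_inner hg.deriv₂ hf.right hf.left hg.derivRight hg.derivLeft
  linear_combination h1 - h2

/-! ### Convolution of `L₂` functions with exponential kernels -/

theorem integrable_exp_neg_mul_abs {c : ℝ} (hc : 0 < c) :
    Integrable fun x : ℝ => Real.exp (-c * |x|) := by
  rw [← integrableOn_univ, ← Set.Iic_union_Ioi (a := (0 : ℝ)), integrableOn_union]
  constructor
  · refine (integrableOn_exp_mul_Iic hc 0).congr_fun (fun x hx => ?_) measurableSet_Iic
    rw [abs_of_nonpos hx]; ring_nf
  · refine (exp_neg_integrableOn_Ioi 0 hc).congr_fun (fun x hx => ?_) measurableSet_Ioi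
    rw [abs_of_pos hx]

theorem memLp_exp_neg_mul_abs {c : ℝ} (hc : 0 < c) (x : ℝ) :
    MemLp (fun s : ℝ => Real.exp (-c * |x - s|)) 2 volume := by
  rw [memLp_two_iff_integrable_sq (by fun_prop)]
  refine ((integrable_exp_neg_mul_abs (by positivity : 0 < 2 * c)).comp_sub_left x).congr
    (Eventually.of_forall fun s => ?_)
  simp only
  rw [← Real.exp_nat_mul]
  congr 1
  push_cast; ring

theorem integrable_exp_mul_norm {g : ℝ → ℂ} (hg : MemLp g 2 volume) {c : ℝ} (hc : 0 < c) (x : ℝ) :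
    Integrable fun s => Real.exp (-c * |x - s|) * ‖g s‖ :=
  (memLp_exp_neg_mul_abs hc x).integrable_mul hg.norm

/-- Young's inequality, qualitatively, for an exponential kernel. -/
theorem memLp_integral_exp_mul_norm {g : ℝ → ℂ} (hg : MemLp g 2 volume) {c : ℝ} (hc : 0 < c) :
    MemLp (fun x => ∫ s, Real.exp (-c * |x - s|) * ‖g s‖) 2 volume := by
  have hgs : Integrable fun s => ‖g s‖ ^ 2 :=
    (memLp_two_iff_integrable_sq_norm hg.aestronglyMeasurable).1 hg
  have he := integrable_exp_neg_mul_abs hc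
  have hmeas : AEStronglyMeasurable (fun x => ∫ s, Real.exp (-c * |x - s|) * ‖g s‖) volume := by
    refine AEStronglyMeasurable.integral_prod_right'
      (f := fun z : ℝ × ℝ => Real.exp (-c * |z.1 - z.2|) * ‖g z.2‖) ?_
    exact (by fun_prop : Continuous fun z : ℝ × ℝ => Real.exp (-c * |z.1 - z.2|))
      |>.aestronglyMeasurable.mul hg.aestronglyMeasurable.norm.comp_snd
  rw [memLp_two_iff_integrable_sq hmeas]
  set M : ℝ := ∫ s, Real.exp (-c * |s|) with hM
  have hMx : ∀ x, ∫ s, Real.exp (-c * |x - s|) = M := fun x =>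
    integral_sub_left_eq_self (fun s => Real.exp (-c * |s|)) volume x
  have hI2 : ∀ x, Integrable fun s => Real.exp (-c * |x - s|) * ‖g s‖ ^ 2 := fun x => by
    refine hgs.bdd_mul (c := 1) (by fun_prop) (Eventually.of_forall fun s => ?_)
    rw [Real.norm_of_nonneg (Real.exp_pos _).le, Real.exp_le_one_iff]
    have := abs_nonneg (x - s)
    nlinarith
  have hm : Integrable fun x => ∫ s, Real.exp (-c * |x - s|) * ‖g s‖ ^ 2 := by
    have := (hgs.convolution_integrand (ContinuousLinearMap.mul ℝ ℝ) he).integral_prod_left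
    refine this.congr (Eventually.of_forall fun x => ?_)
    simp only [ContinuousLinearMap.mul_apply']
    refine integral_congr_ae (Eventually.of_forall fun s => ?_)
    simp only [mul_comm]
  refine (hm.const_mul M).mono' (hmeas.pow 2) (Eventually.of_forall fun x => ?_)
  have h1 := he.comp_sub_left x
  have h2 := integrable_exp_mul_norm hg hc x
  -- Cauchy–Schwarz for the weight `exp(-c|x - s|)`: the quadratic `∫ exp(-c|x - s|) (t ‖g s‖ - 1)²
  -- ds` in `t` is nonnegative, so the squared integral is at most `M` times a convolution of two
  -- `L₁` functions.
  have hdisc : discrim (∫ s, Real.exp (-c * |x - s|) * ‖g s‖ ^ 2)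
      (-2 * ∫ s, Real.exp (-c * |x - s|) * ‖g s‖) M ≤ 0 := by
    refine discrim_le_zero fun t => ?_
    have hsum : (∫ s, Real.exp (-c * |x - s|) * ‖g s‖ ^ 2) * (t * t) +
        (-2 * ∫ s, Real.exp (-c * |x - s|) * ‖g s‖) * t + M =
        ∫ s, ((Real.exp (-c * |x - s|) * ‖g s‖ ^ 2) * (t * t) +
          (Real.exp (-c * |x - s|) * ‖g s‖) * (-2 * t) + Real.exp (-c * |x - s|)) := by
      have h3 : Integrable fun s => (Real.exp (-c * |x - s|) * ‖g s‖ ^ 2) * (t * t) +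
          (Real.exp (-c * |x - s|) * ‖g s‖) * (-2 * t) :=
        ((hI2 x).mul_const _).add (h2.mul_const _)
      rw [integral_add h3 h1,
        integral_add ((hI2 x).mul_const _) (h2.mul_const _), integral_mul_const,
        integral_mul_const, hMx]
      ring
    rw [hsum]
    refine integral_nonneg fun s => ?_
    have : (Real.exp (-c * |x - s|) * ‖g s‖ ^ 2) * (t * t) +
        (Real.exp (-c * |x - s|) * ‖g s‖) * (-2 * t) + Real.exp (-c * |x - s|) =
        Real.exp (-c * |x - s|) * (t * ‖g s‖ - 1) ^ 2 := by ring
    simp only [Pi.zero_apply, this]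
    positivity
  rw [Real.norm_of_nonneg (by positivity)]
  rw [discrim] at hdisc
  nlinarith

/-- The kernel equal to `A exp(ikx)` for `x > 0` and to `B exp(-ikx)` for `x ≤ 0`. -/
noncomputable def expKernel (k A B : ℂ) (x : ℝ) : ℂ :=
  if 0 < x then A * Complex.exp (Complex.I * k * x) else B * Complex.exp (-(Complex.I * k * x))

noncomputable def convKernel (k A B : ℂ) (g : ℝ → ℂ) (x : ℝ) : ℂ :=
  ∫ s, expKernel k A B (x - s) * g s

theorem measurable_expKernel (k A B : ℂ) : Measurable (expKernel k A B) :=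
  Measurable.ite measurableSet_Ioi
    (by fun_prop : Continuous fun x : ℝ => A * Complex.exp (Complex.I * k * x)).measurable
    (by fun_prop : Continuous fun x : ℝ => B * Complex.exp (-(Complex.I * k * x))).measurable

theorem norm_expKernel_le (k A B : ℂ) (x : ℝ) :
    ‖expKernel k A B x‖ ≤ (‖A‖ + ‖B‖) * Real.exp (-k.im * |x|) := by
  rw [expKernel]
  split_ifs with hx
  · rw [norm_mul, Complex.norm_exp, abs_of_pos hx]
    simp only [Complex.mul_re, Complex.I_re, Complex.I_im, Complex.mul_im, Complex.ofReal_re,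
      Complex.ofReal_im]
    ring_nf
    nlinarith [mul_nonneg (Real.exp_pos (-(k.im * x))).le (norm_nonneg B)]
  · rw [norm_mul, Complex.norm_exp, abs_of_nonpos (not_lt.1 hx)]
    simp only [Complex.mul_re, Complex.I_re, Complex.I_im, Complex.mul_im, Complex.ofReal_re,
      Complex.ofReal_im, Complex.neg_re]
    ring_nf
    nlinarith [mul_nonneg (Real.exp_pos (k.im * x)).le (norm_nonneg A)]

theorem expKernel_smul (k c A B : ℂ) (x : ℝ) :
    expKernel k (c * A) (c * B) x = c * expKernel k A B x := by
  simp only [expKernel]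
  split_ifs <;> ring

theorem G_eq_expKernel (k : ℂ) (x : ℝ) :
    G k x = expKernel k (Complex.I / (2 * k)) (Complex.I / (2 * k)) x := by
  rw [G, expKernel]
  split_ifs with hx
  · rw [abs_of_pos hx]
  · rw [abs_of_nonpos (not_lt.1 hx)]; push_cast; ring_nf

theorem convG_eq_convKernel (k : ℂ) (p : ℝ → ℂ) :
    convG k p = convKernel k (Complex.I / (2 * k)) (Complex.I / (2 * k)) p := by
  ext x
  simp only [convG, convKernel, G_eq_expKernel]

theorem convKernel_smul (k c A B : ℂ) (g : ℝ → ℂ) (x : ℝ) :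
    convKernel k (c * A) (c * B) g x = c * convKernel k A B g x := by
  simp only [convKernel, expKernel_smul, mul_assoc, integral_const_mul]

theorem memLp_expKernel {k : ℂ} (hk : 0 < k.im) (A B : ℂ) :
    MemLp (expKernel k A B) 2 volume := by
  have := (memLp_exp_neg_mul_abs hk 0).const_mul (‖A‖ + ‖B‖)
  refine this.of_le (measurable_expKernel k A B).aestronglyMeasurable
    (Eventually.of_forall fun x => (norm_expKernel_le k A B x).trans (le_of_eq ?_))
  rw [Real.norm_of_nonneg (by positivity), zero_sub, abs_neg]

theorem aestronglyMeasurable_expKernel_mul (k A B : ℂ) {g : ℝ → ℂ} (hg : MemLp g 2 volume) :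
    AEStronglyMeasurable (fun z : ℝ × ℝ => expKernel k A B (z.1 - z.2) * g z.2)
      (volume.prod volume) :=
  ((measurable_expKernel k A B).comp (measurable_fst.sub measurable_snd)).aestronglyMeasurable.mul
    hg.aestronglyMeasurable.comp_snd

theorem norm_expKernel_mul_le (k A B : ℂ) (g : ℝ → ℂ) (x s : ℝ) :
    ‖expKernel k A B (x - s) * g s‖ ≤
      (‖A‖ + ‖B‖) * (Real.exp (-k.im * |x - s|) * ‖g s‖) := by
  rw [norm_mul, ← mul_assoc]
  exact mul_le_mul_of_nonneg_right (norm_expKernel_le _ _ _ _) (norm_nonneg _)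

theorem integrable_expKernel_mul {k : ℂ} (hk : 0 < k.im) (A B : ℂ) {g : ℝ → ℂ}
    (hg : MemLp g 2 volume) (x : ℝ) : Integrable fun s => expKernel k A B (x - s) * g s := by
  refine ((integrable_exp_mul_norm hg hk x).const_mul (‖A‖ + ‖B‖)).mono' ?_
    (Eventually.of_forall fun s => norm_expKernel_mul_le k A B g x s)
  exact ((measurable_expKernel k A B).comp
    (measurable_const.sub measurable_id)).aestronglyMeasurable.mul hg.aestronglyMeasurable

theorem memLp_convKernel {k : ℂ} (hk : 0 < k.im) (A B : ℂ) {g : ℝ → ℂ} (hg : MemLp g 2 volume) :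
    MemLp (convKernel k A B g) 2 volume := by
  refine ((memLp_integral_exp_mul_norm hg hk).const_mul (‖A‖ + ‖B‖)).of_le
    (aestronglyMeasurable_expKernel_mul k A B hg).integral_prod_right'
    (Eventually.of_forall fun x => ?_)
  rw [← integral_const_mul]
  refine (norm_integral_le_of_norm_le ((integrable_exp_mul_norm hg hk x).const_mul (‖A‖ + ‖B‖))
    (Eventually.of_forall fun s => norm_expKernel_mul_le k A B g x s)).trans (le_abs_self _)

/-- Dominated convergence: for fixed `s ≠ 0` the jump of the kernel stays away from `x = 0`. For
`|x| < 1` the triangle inequality bounds the translated exponential by `exp(Im k)` times the one at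
`x = 0`. -/
theorem continuousAt_convKernel {k : ℂ} (hk : 0 < k.im) (A B : ℂ) {g : ℝ → ℂ}
    (hg : MemLp g 2 volume) : ContinuousAt (convKernel k A B g) 0 := by
  refine continuousAt_of_dominated
    (bound := fun s => (‖A‖ + ‖B‖) * Real.exp k.im * (Real.exp (-k.im * |0 - s|) * ‖g s‖))
    (Eventually.of_forall fun x =>
      (integrable_expKernel_mul hk A B hg x).aestronglyMeasurable) ?_
    ((integrable_exp_mul_norm hg hk 0).const_mul _) ?_
  · filter_upwards [Metric.ball_mem_nhds (0 : ℝ) one_pos] with x hx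
    refine Eventually.of_forall fun s => (norm_expKernel_mul_le k A B g x s).trans ?_
    rw [mul_assoc]
    refine mul_le_mul_of_nonneg_left ?_ (by positivity)
    rw [← mul_assoc, ← Real.exp_add]
    refine mul_le_mul_of_nonneg_right (Real.exp_le_exp.2 ?_) (norm_nonneg _)
    rw [Metric.mem_ball, Real.dist_eq, sub_zero] at hx
    have : |0 - s| ≤ |x| + |x - s| := by
      have := abs_sub (x - s) x
      rw [show x - s - x = 0 - s by ring] at this
      linarith
    nlinarith
  · have h0 : ∀ᵐ s ∂(volume : Measure ℝ), s ≠ 0 := by simp [ae_iff]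
    filter_upwards [h0] with s hs
    refine ContinuousAt.mul ?_ continuousAt_const
    rcases lt_or_gt_of_ne hs with h | h
    · have : (fun x : ℝ => expKernel k A B (x - s)) =ᶠ[𝓝 0]
          fun x : ℝ => A * Complex.exp (Complex.I * k * ((x - s : ℝ) : ℂ)) := by
        filter_upwards [Ioi_mem_nhds h] with x hx
        rw [expKernel, if_pos (sub_pos.2 hx)]
      exact (by fun_prop : Continuous fun x : ℝ =>
        A * Complex.exp (Complex.I * k * ((x - s : ℝ) : ℂ))).continuousAt.congr this.symm
    · have : (fun x : ℝ => expKernel k A B (x - s)) =ᶠ[𝓝 0]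
          fun x : ℝ => B * Complex.exp (-(Complex.I * k * ((x - s : ℝ) : ℂ))) := by
        filter_upwards [Iio_mem_nhds h] with x hx
        rw [expKernel, if_neg (not_lt.2 (sub_nonpos.2 (le_of_lt hx)))]
      exact (by fun_prop : Continuous fun x : ℝ =>
        B * Complex.exp (-(Complex.I * k * ((x - s : ℝ) : ℂ)))).continuousAt.congr this.symm

theorem integrable_smul_exp {ψ : ℝ → ℝ} (hψ : Continuous ψ) (hc : HasCompactSupport ψ) (A c : ℂ) :
    Integrable fun x : ℝ => ψ x • (A * Complex.exp (c * x)) :=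
  (by fun_prop : Continuous fun x : ℝ => ψ x • (A * Complex.exp (c * x)))
    |>.integrable_of_hasCompactSupport hc.smul_right

theorem deriv_smul_exp {ψ : ℝ → ℝ} (hψ : ContDiff ℝ ∞ ψ) (A c : ℂ) :
    deriv (fun x : ℝ => ψ x • (A * Complex.exp (c * x))) = fun x : ℝ =>
      deriv ψ x • (A * Complex.exp (c * x)) + ψ x • (c * A * Complex.exp (c * x)) := by
  ext x
  have h1 : HasDerivAt ψ (deriv ψ x) x :=
    (hψ.differentiable (by simp)).differentiableAt.hasDerivAt
  have h2 : HasDerivAt (fun x : ℝ => A * Complex.exp (c * x))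
      (c * A * Complex.exp (c * x)) x := by
    have := (((hasDerivAt_id' x).ofReal_comp.const_mul c).cexp).const_mul A
    refine this.congr_deriv ?_
    rw [Complex.ofReal_one]
    ring
  rw [(h1.fun_smul h2).deriv, add_comm]

theorem contDiff_smul_exp {ψ : ℝ → ℝ} (hψ : ContDiff ℝ ∞ ψ) (A c : ℂ) :
    ContDiff ℝ 1 fun x : ℝ => ψ x • (A * Complex.exp (c * x)) := by
  have h1 : ContDiff ℝ 1 ψ := hψ.of_le (by exact_mod_cast le_top)
  exact h1.smul (contDiff_const.mul (contDiff_const.mul Complex.ofRealCLM.contDiff).cexp)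

theorem integral_Ioi_deriv_smul_mul_exp {ψ : ℝ → ℝ} (hψ : ContDiff ℝ ∞ ψ)
    (hc : HasCompactSupport ψ) (A c : ℂ) :
    ∫ x in Set.Ioi (0 : ℝ), deriv ψ x • (A * Complex.exp (c * x)) =
      -(ψ 0 • A) - ∫ x in Set.Ioi (0 : ℝ), ψ x • (c * A * Complex.exp (c * x)) := by
  have := HasCompactSupport.integral_Ioi_deriv_eq (contDiff_smul_exp hψ A c)
    hc.smul_right 0
  rw [deriv_smul_exp hψ, integral_add
    (integrable_smul_exp (hψ.continuous_deriv (by simp)) hc.deriv A c).integrableOn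
    (integrable_smul_exp hψ.continuous hc (c * A) c).integrableOn] at this
  simp only [Complex.ofReal_zero, mul_zero, Complex.exp_zero, mul_one] at this
  rw [← this]; ring

theorem integral_Iic_deriv_smul_mul_exp {ψ : ℝ → ℝ} (hψ : ContDiff ℝ ∞ ψ)
    (hc : HasCompactSupport ψ) (A c : ℂ) :
    ∫ x in Set.Iic (0 : ℝ), deriv ψ x • (A * Complex.exp (c * x)) =
      ψ 0 • A - ∫ x in Set.Iic (0 : ℝ), ψ x • (c * A * Complex.exp (c * x)) := by
  have := HasCompactSupport.integral_Iic_deriv_eq (contDiff_smul_exp hψ A c)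
    hc.smul_right 0
  rw [deriv_smul_exp hψ, integral_add
    (integrable_smul_exp (hψ.continuous_deriv (by simp)) hc.deriv A c).integrableOn
    (integrable_smul_exp hψ.continuous hc (c * A) c).integrableOn] at this
  simp only [Complex.ofReal_zero, mul_zero, Complex.exp_zero, mul_one] at this
  rw [← this]; ring

theorem integrable_smul_expKernel {ψ : ℝ → ℝ} (hψ : Continuous ψ) (hc : HasCompactSupport ψ)
    {k : ℂ} (hk : 0 < k.im) (A B : ℂ) : Integrable fun x => ψ x • expKernel k A B x :=
  ((memLp_expKernel hk A B).locallyIntegrable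
    (by norm_num)).integrable_smul_left_of_hasCompactSupport hψ hc

theorem integral_smul_expKernel {ψ : ℝ → ℝ} (hψ : Continuous ψ) (hc : HasCompactSupport ψ)
    {k : ℂ} (hk : 0 < k.im) (A B : ℂ) :
    ∫ x, ψ x • expKernel k A B x =
      (∫ x in Set.Iic (0 : ℝ), ψ x • (B * Complex.exp (-(Complex.I * k) * x))) +
      ∫ x in Set.Ioi (0 : ℝ), ψ x • (A * Complex.exp (Complex.I * k * x)) := by
  have hi := integrable_smul_expKernel hψ hc hk A B
  rw [← intervalIntegral.integral_Iic_add_Ioi (b := 0) hi.integrableOn hi.integrableOn]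
  congr 1
  · refine setIntegral_congr_fun measurableSet_Iic fun x hx => ?_
    simp only [expKernel, if_neg (not_lt.2 (Set.mem_Iic.1 hx)), neg_mul]
  · refine setIntegral_congr_fun measurableSet_Ioi fun x hx => ?_
    simp only [expKernel, if_pos (Set.mem_Ioi.1 hx)]

/-- Two-sided exponentials are closed under differentiation away from `0`, with coefficients `(A,
B)` becoming `(ikA, -ikB)`; the jump `A - B` contributes a point mass at `0`. -/
theorem integral_deriv_smul_expKernel {ψ : ℝ → ℝ} (hψ : ContDiff ℝ ∞ ψ)
    (hc : HasCompactSupport ψ) {k : ℂ} (hk : 0 < k.im) (A B : ℂ) :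
    ∫ x, deriv ψ x • expKernel k A B x = -(ψ 0 • (A - B)) -
      ∫ x, ψ x • expKernel k (Complex.I * k * A) (-(Complex.I * k) * B) x := by
  rw [integral_smul_expKernel (hψ.continuous_deriv (by simp)) hc.deriv hk,
    integral_smul_expKernel hψ.continuous hc hk, integral_Ioi_deriv_smul_mul_exp hψ hc,
    integral_Iic_deriv_smul_mul_exp hψ hc, smul_sub]
  ring

theorem integral_deriv_smul_expKernel_sub {φ : ℝ → ℝ} (hφ : ContDiff ℝ ∞ φ)
    (hc : HasCompactSupport φ) {k : ℂ} (hk : 0 < k.im) (A B : ℂ) (s : ℝ) :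
    ∫ x, deriv φ x • expKernel k A B (x - s) = -(φ s • (A - B)) -
      ∫ x, φ x • expKernel k (Complex.I * k * A) (-(Complex.I * k) * B) (x - s) := by
  have h := integral_deriv_smul_expKernel (ψ := fun x => φ (x + s))
    (hφ.comp (contDiff_id.add contDiff_const))
    (hc.comp_homeomorph (Homeomorph.addRight s)) hk A B
  simp only [deriv_comp_add_const, zero_add] at h
  rw [← integral_add_right_eq_self _ s, ← integral_add_right_eq_self
    (fun x => φ x • expKernel k (Complex.I * k * A) (-(Complex.I * k) * B) (x - s)) s]
  simpa only [add_sub_cancel_right] using h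

theorem integrable_smul_expKernel_mul {φ : ℝ → ℝ} (hφ : Continuous φ) (hc : HasCompactSupport φ)
    {k : ℂ} (hk : 0 < k.im) (A B : ℂ) {g : ℝ → ℂ} (hg : MemLp g 2 volume) :
    Integrable (Function.uncurry fun x s => φ x • (expKernel k A B (x - s) * g s))
      (volume.prod volume) := by
  have hm : AEStronglyMeasurable
      (Function.uncurry fun x s => φ x • (expKernel k A B (x - s) * g s))
      (volume.prod volume) :=
    (hφ.comp continuous_fst).aestronglyMeasurable.smul
      (aestronglyMeasurable_expKernel_mul k A B hg)
  refine (integrable_prod_iff hm).2 ⟨Eventually.of_forall fun x =>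
    (integrable_expKernel_mul hk A B hg x).smul (φ x), ?_⟩
  have hP := (((memLp_integral_exp_mul_norm hg hk).const_mul (‖A‖ + ‖B‖)).locallyIntegrable
    (by norm_num)).integrable_smul_left_of_hasCompactSupport hφ.norm hc.norm
  refine hP.mono' hm.norm.integral_prod_right' (Eventually.of_forall fun x => ?_)
  rw [Real.norm_of_nonneg (integral_nonneg fun s => norm_nonneg _)]
  simp only [Function.uncurry_apply_pair, norm_smul, integral_const_mul, smul_eq_mul]
  refine mul_le_mul_of_nonneg_left ?_ (norm_nonneg _)
  rw [← integral_const_mul]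
  exact integral_mono (integrable_expKernel_mul hk A B hg x).norm
    ((integrable_exp_mul_norm hg hk x).const_mul _) fun s => norm_expKernel_mul_le k A B g x s

theorem integral_smul_convKernel {φ : ℝ → ℝ} (hφ : Continuous φ) (hc : HasCompactSupport φ)
    {k : ℂ} (hk : 0 < k.im) (A B : ℂ) {g : ℝ → ℂ} (hg : MemLp g 2 volume) :
    ∫ x, φ x • convKernel k A B g x = ∫ s, (∫ x, φ x • expKernel k A B (x - s)) * g s := by
  have := integral_integral_swap (integrable_smul_expKernel_mul hφ hc hk A B hg)
  simp only [convKernel, ← integral_smul]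
  rw [this]
  refine integral_congr_ae (Eventually.of_forall fun s => ?_)
  simp only [← smul_mul_assoc, integral_mul_const]

theorem integrable_integral_smul_expKernel_mul {φ : ℝ → ℝ} (hφ : Continuous φ)
    (hc : HasCompactSupport φ) {k : ℂ} (hk : 0 < k.im) (A B : ℂ) {g : ℝ → ℂ}
    (hg : MemLp g 2 volume) :
    Integrable fun s => (∫ x, φ x • expKernel k A B (x - s)) * g s := by
  refine (integrable_smul_expKernel_mul hφ hc hk A B hg).integral_prod_right.congr
    (Eventually.of_forall fun s => ?_)
  simp only [Function.uncurry_apply_pair, ← smul_mul_assoc, integral_mul_const]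

/-- By Fubini the derivative falls on the translated kernel, whose point mass at `s` reproduces `(A
- B) g`. -/
theorem integral_deriv_smul_convKernel {φ : ℝ → ℝ} (hφ : ContDiff ℝ ∞ φ)
    (hc : HasCompactSupport φ) {k : ℂ} (hk : 0 < k.im) (A B : ℂ) {g : ℝ → ℂ}
    (hg : MemLp g 2 volume) :
    ∫ x, deriv φ x • convKernel k A B g x = -(∫ x, φ x • ((A - B) * g x)) -
      ∫ x, φ x • convKernel k (Complex.I * k * A) (-(Complex.I * k) * B) g x := by
  rw [integral_smul_convKernel (hφ.continuous_deriv (by simp)) hc.deriv hk A B hg,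
    integral_smul_convKernel hφ.continuous hc hk _ _ hg, ← integral_neg, ← integral_sub]
  · refine integral_congr_ae (Eventually.of_forall fun s => ?_)
    simp only [integral_deriv_smul_expKernel_sub hφ hc hk]
    rw [Complex.real_smul, Complex.real_smul]
    ring
  · exact (((hg.const_mul (A - B)).locallyIntegrable
      (by norm_num)).integrable_smul_left_of_hasCompactSupport hφ.continuous hc).neg
  · exact integrable_integral_smul_expKernel_mul hφ.continuous hc hk _ _ hg

/-! ### Kernels and Green potentials as Sobolev functions -/

/-- The kernel as an element of `L₂(ℝ)`. -/
noncomputable def kernelL2 {k : ℂ} (hk : 0 < k.im) (A B : ℂ) : L2 := (memLp_expKernel hk A B).toLp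

/-- The convolution with the kernel as an element of `L₂(ℝ)`. -/
noncomputable def convL2 {k : ℂ} (hk : 0 < k.im) (A B : ℂ) (g : L2) : L2 :=
  (memLp_convKernel hk A B (Lp.memLp g)).toLp

theorem coeFn_kernelL2 {k : ℂ} (hk : 0 < k.im) (A B : ℂ) :
    kernelL2 hk A B =ᵐ[volume] expKernel k A B := MemLp.coeFn_toLp _

theorem coeFn_convL2 {k : ℂ} (hk : 0 < k.im) (A B : ℂ) (g : L2) :
    convL2 hk A B g =ᵐ[volume] convKernel k A B g := MemLp.coeFn_toLp _

theorem kernelL2_smul {k : ℂ} (hk : 0 < k.im) (c A B : ℂ) :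
    kernelL2 hk (c * A) (c * B) = c • kernelL2 hk A B := by
  refine Lp.ext ?_
  filter_upwards [coeFn_kernelL2 hk (c * A) (c * B), coeFn_kernelL2 hk A B,
    Lp.coeFn_smul c (kernelL2 hk A B)] with x h1 h2 h3
  rw [h1, h3, Pi.smul_apply, h2, expKernel_smul, smul_eq_mul]

theorem convL2_smul {k : ℂ} (hk : 0 < k.im) (c A B : ℂ) (g : L2) :
    convL2 hk (c * A) (c * B) g = c • convL2 hk A B g := by
  refine Lp.ext ?_
  filter_upwards [coeFn_convL2 hk (c * A) (c * B) g, coeFn_convL2 hk A B g,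
    Lp.coeFn_smul c (convL2 hk A B g)] with x h1 h2 h3
  rw [h1, h3, Pi.smul_apply, h2, convKernel_smul, smul_eq_mul]

theorem isWeakDeriv_kernelL2 {k : ℂ} (hk : 0 < k.im) (A B : ℂ) :
    IsWeakDeriv (kernelL2 hk A B)
      (kernelL2 hk (Complex.I * k * A) (-(Complex.I * k) * B)) := by
  intro φ h1 h2 h3
  have e : ∀ (ψ : ℝ → ℝ) (A B : ℂ),
      ∫ x, ψ x • kernelL2 hk A B x = ∫ x, ψ x • expKernel k A B x := fun ψ A B =>
    integral_congr_ae ((coeFn_kernelL2 hk A B).mono fun x hx => by simp only [hx])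
  have h0 : φ 0 = 0 := image_eq_zero_of_notMem_tsupport fun h => h3 h rfl
  rw [e, e, integral_deriv_smul_expKernel h1 h2 hk, h0, zero_smul]
  ring

theorem isWeakDeriv_convL2 {k : ℂ} (hk : 0 < k.im) (A B : ℂ) (g : L2) :
    IsWeakDeriv (convL2 hk A B g)
      ((A - B) • g + convL2 hk (Complex.I * k * A) (-(Complex.I * k) * B) g) := by
  intro φ h1 h2 _
  have e : ∀ (ψ : ℝ → ℝ) (A B : ℂ),
      ∫ x, ψ x • convL2 hk A B g x = ∫ x, ψ x • convKernel k A B g x := fun ψ A B =>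
    integral_congr_ae ((coeFn_convL2 hk A B g).mono fun x hx => by simp only [hx])
  have e2 : ∫ x, φ x • ((A - B) • g + convL2 hk (Complex.I * k * A) (-(Complex.I * k) * B) g : L2) x
      = ∫ x, (φ x • ((A - B) * g x) +
        φ x • convL2 hk (Complex.I * k * A) (-(Complex.I * k) * B) g x) := by
    refine integral_congr_ae ?_
    filter_upwards [Lp.coeFn_add ((A - B) • g)
      (convL2 hk (Complex.I * k * A) (-(Complex.I * k) * B) g),
      Lp.coeFn_smul (A - B) g] with x hx hx2
    rw [hx, Pi.add_apply, hx2, Pi.smul_apply, smul_add, smul_eq_mul]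
  rw [e2, integral_add _ (integrable_test_smul h1.continuous h2 _), e, e,
    integral_deriv_smul_convKernel h1 h2 hk A B (Lp.memLp g)]
  · ring
  · exact (((Lp.memLp g).const_mul (A - B)).locallyIntegrable
      (by norm_num)).integrable_smul_left_of_hasCompactSupport h1.continuous h2

theorem hasRightLimit_kernelL2 {k : ℂ} (hk : 0 < k.im) (A B : ℂ) :
    HasRightLimit (kernelL2 hk A B) A := by
  have h : Tendsto (fun x : ℝ => A * Complex.exp (Complex.I * k * x)) (𝓝 0) (𝓝 A) := by
    have := (by fun_prop : Continuous fun x : ℝ => A * Complex.exp (Complex.I * k * x)).tendsto 0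
    simpa using this
  refine (h.mono_left (inf_le_left.trans nhdsWithin_le_nhds)).congr' ?_
  have h1 : ∀ᶠ x in 𝓝[>] (0 : ℝ) ⊓ ae (volume : Measure ℝ), 0 < x :=
    mem_inf_of_left self_mem_nhdsWithin
  filter_upwards [h1, (coeFn_kernelL2 hk A B).filter_mono inf_le_right] with x hx hx2
  rw [hx2, expKernel, if_pos hx]

theorem hasLeftLimit_kernelL2 {k : ℂ} (hk : 0 < k.im) (A B : ℂ) :
    HasLeftLimit (kernelL2 hk A B) B := by
  have h : Tendsto (fun x : ℝ => B * Complex.exp (-(Complex.I * k * x))) (𝓝 0) (𝓝 B) := by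
    have := (by fun_prop :
      Continuous fun x : ℝ => B * Complex.exp (-(Complex.I * k * x))).tendsto 0
    simpa using this
  refine (h.mono_left (inf_le_left.trans nhdsWithin_le_nhds)).congr' ?_
  have h1 : ∀ᶠ x in 𝓝[<] (0 : ℝ) ⊓ ae (volume : Measure ℝ), x < 0 :=
    mem_inf_of_left self_mem_nhdsWithin
  filter_upwards [h1, (coeFn_kernelL2 hk A B).filter_mono inf_le_right] with x hx hx2
  rw [hx2, expKernel, if_neg (not_lt.2 hx.le)]

theorem tendsto_convL2 {k : ℂ} (hk : 0 < k.im) (A B : ℂ) (g : L2) {l : Filter ℝ} (hl : l ≤ 𝓝 0) :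
    Tendsto (convL2 hk A B g) (l ⊓ ae (volume : Measure ℝ)) (𝓝 (convKernel k A B g 0)) :=
  ((continuousAt_convKernel hk A B (Lp.memLp g)).tendsto.mono_left (inf_le_left.trans hl)).congr'
    (EventuallyEq.symm ((coeFn_convL2 hk A B g).filter_mono inf_le_right))

theorem ne_zero_of_im_pos {k : ℂ} (hk : 0 < k.im) : k ≠ 0 := fun h => by simp [h] at hk

theorem isSobolev_exp {k : ℂ} (hk : 0 < k.im) :
    IsSobolev (kernelL2 hk 1 1) (kernelL2 hk (Complex.I * k) (-(Complex.I * k)))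
      (-(k ^ 2) • kernelL2 hk 1 1) 1 1 (Complex.I * k) (-(Complex.I * k)) where
  deriv₁ := by simpa using isWeakDeriv_kernelL2 hk 1 1
  deriv₂ := by
    have := isWeakDeriv_kernelL2 hk (Complex.I * k) (-(Complex.I * k))
    rw [← kernelL2_smul]
    convert this using 2 <;> linear_combination -k ^ 2 * Complex.I_sq
  right := hasRightLimit_kernelL2 hk _ _
  left := hasLeftLimit_kernelL2 hk _ _
  derivRight := hasRightLimit_kernelL2 hk _ _
  derivLeft := hasLeftLimit_kernelL2 hk _ _

/-- `G * g`, as an element of `L₂(ℝ)`. -/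
noncomputable def greenL2 {k : ℂ} (hk : 0 < k.im) (g : L2) : L2 :=
  convL2 hk (Complex.I / (2 * k)) (Complex.I / (2 * k)) g

theorem coeFn_greenL2 {k : ℂ} (hk : 0 < k.im) (g : L2) :
    greenL2 hk g =ᵐ[volume] convG k g := by
  rw [convG_eq_convKernel]
  exact coeFn_convL2 hk _ _ g

/-- `G` is the fundamental solution of `-y'' - k² y`. It is continuous at `0`, so the first
derivative carries no point mass; the kernel of `G'` has coefficients `(-1/2, 1/2)`, and its jump
`-1` produces the term `-g`. -/
theorem isSobolev_greenL2 {k : ℂ} (hk : 0 < k.im) (g : L2) :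
    ∃ (g' : L2) (D : ℂ), IsSobolev (greenL2 hk g) g' (-(k ^ 2) • greenL2 hk g - g)
      (convG k g 0) (convG k g 0) D D := by
  have hk0 := ne_zero_of_im_pos hk
  refine ⟨convL2 hk (-1 / 2) (1 / 2) g, convKernel k (-1 / 2) (1 / 2) g 0, ?_, ?_, ?_, ?_,
    tendsto_convL2 hk _ _ g nhdsWithin_le_nhds, tendsto_convL2 hk _ _ g nhdsWithin_le_nhds⟩
  · have := isWeakDeriv_convL2 hk (Complex.I / (2 * k)) (Complex.I / (2 * k)) g
    rw [sub_self, zero_smul, zero_add] at this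
    have e1 : Complex.I * k * (Complex.I / (2 * k)) = -1 / 2 := by
      field_simp; rw [Complex.I_sq]
    have e2 : -(Complex.I * k) * (Complex.I / (2 * k)) = 1 / 2 := by
      field_simp; rw [Complex.I_sq]; ring
    rwa [e1, e2] at this
  · have := isWeakDeriv_convL2 hk (-1 / 2) (1 / 2) g
    rw [greenL2, ← convL2_smul]
    convert this using 1
    rw [sub_eq_neg_add]
    congr 1
    · norm_num
    · congr 1 <;> field_simp
  · rw [convG_eq_convKernel]; exact tendsto_convL2 hk _ _ g nhdsWithin_le_nhds
  · rw [convG_eq_convKernel]; exact tendsto_convL2 hk _ _ g nhdsWithin_le_nhds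

/-! ### Weyl solutions and Dirichlet solutions -/

theorem IsSobolev.congr {f f' f'' g g'' : L2} {fR fL gR gL dR dL : ℂ}
    (h : IsSobolev f f' f'' fR fL dR dL) (h₀ : g = f) (h₂ : g'' = f'') (hR : gR = fR)
    (hL : gL = fL) : IsSobolev g f' g'' gR gL dR dL := by
  subst h₀ h₂ hR hL
  exact h

/-- `u` solves `-u'' + q = lam u` on `ℝ \ {0}` with `u(0) = 1` and `u_s'(0) = W + (q, u)`. -/
def IsWeylSolution (q : L2) (lam W : ℂ) (u : L2) : Prop :=
  ∃ (u' : L2) (dR dL : ℂ), IsSobolev u u' (-lam • u + q) 1 1 dR dL ∧ dR - dL = W + inner ℂ q u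

/-- `d` solves `-d'' - lam d = g` on `ℝ \ {0}` with `d(0) = 0`. -/
def IsDirichletSolution (lam : ℂ) (g d : L2) : Prop :=
  ∃ (d' : L2) (dR dL : ℂ), IsSobolev d d' (-lam • d - g) 0 0 dR dL

theorem convG_zero_eq_integral (k : ℂ) (p : ℝ → ℂ) :
    convG k p 0 = Complex.I / (2 * k) * ∫ s, expKernel k 1 1 s * p s := by
  rw [convG, ← integral_const_mul]
  refine integral_congr_ae (Eventually.of_forall fun s => ?_)
  simp only
  rw [← mul_assoc, ← expKernel_smul, mul_one, ← G_eq_expKernel, G, G, zero_sub, abs_neg]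

theorem inner_kernelL2 {k : ℂ} (hk : 0 < k.im) (q : L2) :
    inner ℂ q (kernelL2 hk 1 1) = -(2 * Complex.I * k) * convG k (fun x => conj (q x)) 0 := by
  have hk0 := ne_zero_of_im_pos hk
  rw [inner_eq_integral, convG_zero_eq_integral]
  have : ∫ x, conj (q x) * kernelL2 hk 1 1 x = ∫ s, expKernel k 1 1 s * conj (q s) :=
    integral_congr_ae ((coeFn_kernelL2 hk 1 1).mono fun x hx => by simp only [hx, mul_comm])
  rw [this]
  field_simp
  linear_combination (∫ s, expKernel k 1 1 s * conj (q s)) * Complex.I_sq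

theorem inner_greenL2 {k : ℂ} (hk : 0 < k.im) (q g : L2) :
    inner ℂ q (greenL2 hk g) = ∫ x, conj (q x) * convG k g x := by
  rw [inner_eq_integral]
  exact integral_congr_ae ((coeFn_greenL2 hk g).mono fun x hx => by simp only [hx])

theorem exists_isWeylSolution (q : L2) {lam : ℂ} (h : -lam ∈ Complex.slitPlane) :
    ∃ u, IsWeylSolution q lam (weyl q lam) u := by
  have hk := sqrtUpper_im_pos h
  have hk2 := sqrtUpper_sq lam
  have hw : weyl q lam = inner ℂ q (greenL2 hk q) +
      2 * Complex.I * sqrtUpper lam * (1 + convG (sqrtUpper lam) q 0) *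
        (1 + convG (sqrtUpper lam) (fun x => conj (q x)) 0) := by
    rw [inner_greenL2]; rfl
  set k := sqrtUpper lam
  obtain ⟨g', D, hg⟩ := isSobolev_greenL2 hk q
  have hs := ((isSobolev_exp hk).smul (1 + convG k q 0)).add (hg.smul (-1))
  -- `-(G * q)` solves the inhomogeneous equation, and the multiple of `exp(ik|x|)` normalises the
  -- value at `0` to `1`. Its derivative jump and its product with `q` supply the terms of `weyl`
  -- containing `2ik`.
  refine ⟨(1 + convG k q 0) • kernelL2 hk 1 1 + (-1 : ℂ) • greenL2 hk q, _, _, _,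
    hs.congr rfl ?_ (by ring) (by ring), ?_⟩
  · rw [hk2]; module
  · rw [hw, inner_add_right, inner_smul_right, inner_smul_right, inner_kernelL2]
    ring

theorem exists_isDirichletSolution {lam : ℂ} (h : -lam ∈ Complex.slitPlane) (g : L2) :
    ∃ d, IsDirichletSolution lam g d := by
  have hk := sqrtUpper_im_pos h
  have hk2 := sqrtUpper_sq lam
  set k := sqrtUpper lam
  obtain ⟨g', D, hg⟩ := isSobolev_greenL2 hk g
  have hs := hg.add ((isSobolev_exp hk).smul (-convG k g 0))
  refine ⟨greenL2 hk g + (-convG k g 0) • kernelL2 hk 1 1, _, _, _,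
    hs.congr rfl ?_ (by ring) (by ring)⟩
  rw [hk2]; module

/-! ### The Dirichlet resolvent -/

theorem IsDirichletSolution.inner_eq {lam : ℂ} {g d : L2} (h : IsDirichletSolution lam g d) :
    ∃ t : ℝ, 0 ≤ t ∧ inner ℂ d g = t - lam * (‖d‖ ^ 2 : ℝ) := by
  obtain ⟨d', dR, dL, hd⟩ := h
  refine ⟨‖d'‖ ^ 2, by positivity, ?_⟩
  have := hd.inner_second hd
  rw [inner_sub_right, inner_smul_right, inner_self_eq_norm_sq_to_K, inner_self_eq_norm_sq_to_K]
    at this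
  simp only [map_zero, zero_mul] at this
  push_cast
  linear_combination -this

/-- The imaginary and real parts of `(d, g) = ‖d'‖² - lam ‖d‖²` give the two bounds. The real part
is what covers the negative half-axis, where `Im lam = 0`. -/
theorem IsDirichletSolution.norm_le {lam : ℂ} {g d : L2} (h : IsDirichletSolution lam g d) :
    max |lam.im| (-lam.re) * ‖d‖ ≤ ‖g‖ := by
  obtain ⟨t, ht, he⟩ := h.inner_eq
  have hn := norm_inner_le_norm (𝕜 := ℂ) d g
  have key : max |lam.im| (-lam.re) * ‖d‖ ^ 2 ≤ ‖d‖ * ‖g‖ := by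
    rcases max_choice |lam.im| (-lam.re) with hm | hm
    · have h1 := (Complex.abs_im_le_norm _).trans hn
      rw [he, Complex.sub_im, Complex.ofReal_im, Complex.im_mul_ofReal, zero_sub, abs_neg, abs_mul,
        abs_of_nonneg (by positivity : 0 ≤ ‖d‖ ^ 2)] at h1
      rwa [hm]
    · have h1 := (Complex.re_le_norm _).trans hn
      rw [he, Complex.sub_re, Complex.ofReal_re, Complex.re_mul_ofReal] at h1
      rw [hm]; linarith
  rcases (norm_nonneg d).eq_or_lt with h0 | h0
  · rw [← h0, mul_zero]; exact norm_nonneg g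
  · refine le_of_mul_le_mul_left ?_ h0
    linarith

theorem max_abs_im_neg_re_pos {lam : ℂ} (h : -lam ∈ Complex.slitPlane) :
    0 < max |lam.im| (-lam.re) := by
  rcases Complex.mem_slitPlane_iff.1 h with h | h
  · exact lt_max_of_lt_right h
  · exact lt_max_of_lt_left (abs_pos.2 fun h0 => h (by simp [h0]))

theorem neg_mem_slitPlane_of_im_ne_zero {lam : ℂ} (h : lam.im ≠ 0) :
    -lam ∈ Complex.slitPlane :=
  Complex.mem_slitPlane_iff.2 (Or.inr (by simpa using h))

theorem IsDirichletSolution.eq_zero {lam : ℂ} (h : -lam ∈ Complex.slitPlane) {d : L2}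
    (hd : IsDirichletSolution lam 0 d) : d = 0 := by
  have h1 := hd.norm_le
  have h2 := max_abs_im_neg_re_pos h
  rw [norm_zero] at h1
  exact norm_le_zero_iff.1 (nonpos_of_mul_nonpos_right h1 h2)

theorem IsDirichletSolution.add_smul {lam : ℂ} {g₁ g₂ d₁ d₂ : L2} (c : ℂ)
    (h₁ : IsDirichletSolution lam g₁ d₁) (h₂ : IsDirichletSolution lam g₂ d₂) :
    IsDirichletSolution lam (g₁ + c • g₂) (d₁ + c • d₂) := by
  obtain ⟨d', dR, dL, h⟩ := h₁
  obtain ⟨e', eR, eL, k⟩ := h₂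
  exact ⟨_, _, _, (h.add (k.smul c)).congr rfl (by module) (by ring) (by ring)⟩

theorem IsDirichletSolution.eq {lam : ℂ} (h : -lam ∈ Complex.slitPlane) {g d₁ d₂ : L2}
    (h₁ : IsDirichletSolution lam g d₁) (h₂ : IsDirichletSolution lam g d₂) : d₁ = d₂ := by
  have := h₁.add_smul (-1) h₂
  rw [neg_one_smul, neg_one_smul, add_neg_cancel] at this
  exact add_neg_eq_zero.1 (this.eq_zero h)

/-- The resolvent of the Dirichlet Laplacian on `ℝ \ {0}`. -/
theorem exists_dirichletResolvent {lam : ℂ} (h : -lam ∈ Complex.slitPlane) :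
    ∃ D : L2 →L[ℂ] L2, ∀ g, IsDirichletSolution lam g (D g) := by
  choose d hd using exists_isDirichletSolution h
  let T : L2 →ₗ[ℂ] L2 :=
    { toFun := d
      map_add' := fun x y => (hd (x + y)).eq h (by simpa using (hd x).add_smul 1 (hd y))
      map_smul' := fun c x => (hd (c • x)).eq h (by
        have h0 : IsDirichletSolution lam 0 0 := ⟨0, 0, 0, by simpa using isSobolev_zero⟩
        simpa using h0.add_smul c (hd x)) }
  refine ⟨T.mkContinuous (max |lam.im| (-lam.re))⁻¹ fun g => ?_, hd⟩
  rw [inv_mul_eq_div, le_div_iff₀' (max_abs_im_neg_re_pos h)]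
  exact (hd g).norm_le

/-! ### Symmetry, holomorphy and non-constancy of the Weyl–Titchmarsh function -/

/-- Green's identity for `u` and `v`: since both equal `1` at `0`, the boundary terms are the
derivative jumps, and the terms with `q` cancel against those in the definition of `W` and `V`. -/
theorem IsWeylSolution.sub_conj {q : L2} {lam mu W V : ℂ} {u v : L2}
    (hu : IsWeylSolution q lam W u) (hv : IsWeylSolution q mu V v) :
    W - conj V = (lam - conj mu) * inner ℂ v u := by
  obtain ⟨u', dR, dL, h, hW⟩ := hu
  obtain ⟨v', eR, eL, k, hV⟩ := hv
  have hg := h.green k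
  have hV' := congrArg conj hV
  rw [map_sub, map_add, inner_conj_symm] at hV'
  rw [inner_add_right, inner_add_left, inner_smul_right, inner_smul_left, map_one, map_neg] at hg
  linear_combination -hW + hV' + hg

theorem IsWeylSolution.ne_zero {q : L2} {lam W : ℂ} {u : L2} (hu : IsWeylSolution q lam W u) :
    u ≠ 0 := by
  rintro rfl
  obtain ⟨u', dR, dL, h, -⟩ := hu
  exact one_ne_zero h.eq_zero.2.2.1

theorem IsWeylSolution.im_mul_norm_sq {q : L2} {lam W : ℂ} {u : L2}
    (hu : IsWeylSolution q lam W u) : lam.im * ‖u‖ ^ 2 = W.im := by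
  have := hu.sub_conj hu
  rw [inner_self_eq_norm_sq_to_K, Complex.sub_conj, Complex.sub_conj] at this
  have h := congrArg Complex.im this
  simp [← Complex.ofReal_pow] at h
  linarith

theorem IsWeylSolution.isDirichletSolution_sub {q : L2} {lam mu W V : ℂ} {u v : L2}
    (hu : IsWeylSolution q lam W u) (hv : IsWeylSolution q mu V v) :
    IsDirichletSolution lam ((lam - mu) • v) (u - v) := by
  obtain ⟨u', dR, dL, h, -⟩ := hu
  obtain ⟨v', eR, eL, k, -⟩ := hv
  exact ⟨_, _, _, (h.add (k.smul (-1))).congr (by module) (by module) (by ring) (by ring)⟩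

theorem neg_conj_mem_slitPlane {lam : ℂ} (h : -lam ∈ Complex.slitPlane) :
    -conj lam ∈ Complex.slitPlane := by
  rw [Complex.mem_slitPlane_iff] at h ⊢
  simpa using h

theorem weyl_conj (q : L2) {lam : ℂ} (h : -lam ∈ Complex.slitPlane) :
    weyl q (conj lam) = conj (weyl q lam) := by
  obtain ⟨u, hu⟩ := exists_isWeylSolution q h
  obtain ⟨v, hv⟩ := exists_isWeylSolution q (neg_conj_mem_slitPlane h)
  have := hv.sub_conj hu
  rwa [sub_self, zero_mul, sub_eq_zero] at this

/-- With the second point fixed at `conj mu`, the symmetry of `W` turns `IsWeylSolution.sub_conj`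
into a formula for the difference quotient, `(u_{conj mu}, u_lam)`. It converges because `u_lam -
u_mu` is the Dirichlet solution with right side `(lam - mu) u_mu`, so `u` is norm continuous. -/
theorem hasDerivAt_weyl (q : L2) {mu : ℂ} (h : -mu ∈ Complex.slitPlane) :
    ∃ w : ℂ, HasDerivAt (weyl q) w mu := by
  -- The choice is total, with the value `0` on `[0, ∞)`, so that limits in `lam` make sense.
  have hex : ∀ lam : ℂ, ∃ u : L2, -lam ∈ Complex.slitPlane →
      IsWeylSolution q lam (weyl q lam) u := by
    intro lam
    by_cases hl : -lam ∈ Complex.slitPlane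
    · obtain ⟨u, hu⟩ := exists_isWeylSolution q hl
      exact ⟨u, fun _ => hu⟩
    · exact ⟨0, fun h => absurd h hl⟩
  choose u hu using hex
  have hev : ∀ᶠ lam in 𝓝 mu, -lam ∈ Complex.slitPlane :=
    continuous_neg.continuousAt.eventually_mem (Complex.isOpen_slitPlane.mem_nhds h)
  have hcont : Tendsto u (𝓝 mu) (𝓝 (u mu)) := by
    rw [tendsto_iff_norm_sub_tendsto_zero]
    have hlim : Tendsto (fun lam : ℂ => ‖(lam - mu) • u mu‖ / max |lam.im| (-lam.re)) (𝓝 mu)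
        (𝓝 (‖(mu - mu) • u mu‖ / max |mu.im| (-mu.re))) := by
      refine Tendsto.div ?_ ?_ (max_abs_im_neg_re_pos h).ne'
      · exact (by fun_prop : Continuous fun lam : ℂ => ‖(lam - mu) • u mu‖).tendsto mu
      · exact (Complex.continuous_im.abs.max Complex.continuous_re.neg).tendsto mu
    rw [sub_self, zero_smul, norm_zero, zero_div] at hlim
    refine squeeze_zero' (Eventually.of_forall fun _ => norm_nonneg _) ?_ hlim
    filter_upwards [hev] with lam hl
    rw [le_div_iff₀' (max_abs_im_neg_re_pos hl)]
    exact ((hu lam hl).isDirichletSolution_sub (hu mu h)).norm_le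
  refine ⟨inner ℂ (u (conj mu)) (u mu), ?_⟩
  rw [hasDerivAt_iff_tendsto_slope]
  refine ((tendsto_const_nhds.inner hcont).mono_left nhdsWithin_le_nhds).congr' ?_
  filter_upwards [hev.filter_mono nhdsWithin_le_nhds, self_mem_nhdsWithin] with lam hl hne
  have hsub := (hu lam hl).sub_conj (hu _ (neg_conj_mem_slitPlane h))
  rw [weyl_conj q h, Complex.conj_conj, Complex.conj_conj] at hsub
  rw [slope_def_field, hsub, mul_div_cancel_left₀ _ (sub_ne_zero.2 hne)]

/-- Otherwise the identity theorem on the connected domain `ℂ \ [0, ∞)` gives `W = a` throughout,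
while `W(-1)` is real by symmetry. -/
theorem frequently_weyl_ne (q : L2) {mu a : ℂ} (h : -mu ∈ Complex.slitPlane) (ha : a.im ≠ 0) :
    ∃ᶠ lam in 𝓝 mu, weyl q lam ≠ a := by
  intro hcon
  simp only [not_not] at hcon
  have hS : IsOpen (Neg.neg ⁻¹' Complex.slitPlane : Set ℂ) :=
    Complex.isOpen_slitPlane.preimage continuous_neg
  have hconn : IsPreconnected (Neg.neg ⁻¹' Complex.slitPlane : Set ℂ) := by
    have := (Complex.starConvex_one_slitPlane.isPathConnected
      Complex.one_mem_slitPlane).isConnected.isPreconnected.image (fun z : ℂ => -z)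
      continuous_neg.continuousOn
    rwa [Set.image_neg_eq_neg] at this
  have han : AnalyticOnNhd ℂ (weyl q) (Neg.neg ⁻¹' Complex.slitPlane) :=
    DifferentiableOn.analyticOnNhd (fun z hz =>
      (hasDerivAt_weyl q hz).choose_spec.differentiableAt.differentiableWithinAt) hS
  have heq := han.eqOn_of_preconnected_of_eventuallyEq (g := fun _ => a) analyticOnNhd_const
    hconn h hcon
  have h1 : -(-1 : ℂ) ∈ Complex.slitPlane := by rw [neg_neg]; exact Complex.one_mem_slitPlane
  have e1 : weyl q (-1) = a := heq h1
  have e2 := weyl_conj q h1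
  rw [map_neg, map_one, e1] at e2
  exact ha (Complex.conj_eq_iff_im.1 e2.symm)

/-! ### Krein's resolvent formula -/

theorem mem_deltaGraph_iff {q : L2} {a : ℂ} {x y : L2} :
    (x, y) ∈ deltaGraph q a ↔ ∃ h : x ∈ (H q a).domain, H q a ⟨x, h⟩ = y := by
  rw [← H_graph, LinearPMap.mem_graph_iff]
  constructor
  · rintro ⟨⟨z, hz⟩, rfl, h⟩
    exact ⟨hz, h⟩
  · rintro ⟨h, e⟩
    exact ⟨⟨x, h⟩, rfl, e⟩

/-- The function `w - w(0) u` is a homogeneous Dirichlet solution, so `w = w(0) u`; the boundary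
condition for `w` then reads `w(0) (W - a) = 0`. -/
theorem eq_zero_of_eigenvector {q : L2} {a lam W : ℂ} (h : -lam ∈ Complex.slitPlane) {u w : L2}
    (hu : IsWeylSolution q lam W u) (hWa : W ≠ a) (hw : (w, lam • w) ∈ deltaGraph q a) :
    w = 0 := by
  obtain ⟨u', dR, dL, hu, hW⟩ := hu
  obtain ⟨w', w'', wR, wL, eR, eL, hw, h0, h1, h2⟩ := hw
  obtain rfl : wR = wL := sub_eq_zero.1 h0
  simp only at hw h1 h2
  rw [add_self_div_two] at h1 h2
  have hs := hw.add (hu.smul (-wR))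
  have hz : w + (-wR) • u = 0 := by
    have hw2 : w'' = wR • q - lam • w := by rw [h2]; abel
    exact IsDirichletSolution.eq_zero h
      ⟨_, _, _, hs.congr rfl (by rw [hw2]; module) (by ring) (by ring)⟩
  rw [hz] at hs
  obtain ⟨-, -, -, -, hR, hL⟩ := hs.eq_zero
  have hwu : w = wR • u := by rw [neg_smul] at hz; exact add_neg_eq_zero.1 hz
  rw [hwu, inner_smul_right] at h1
  have hc : wR * (W - a) = 0 := by linear_combination -wR * hW + h1 - hR + hL
  rw [hwu, (mul_eq_zero.1 hc).resolve_right (sub_ne_zero.2 hWa), zero_smul]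

/-- Krein's formula for the resolvent of `H_a`. -/
theorem exists_resolvent (q : L2) {a lam : ℂ} (h : -lam ∈ Complex.slitPlane) {u v : L2}
    (hu : IsWeylSolution q lam (weyl q lam) u)
    (hv : IsWeylSolution q (conj lam) (weyl q (conj lam)) v) (hWa : weyl q lam ≠ a) :
    ∃ D R : L2 →L[ℂ] L2, (∀ g, IsDirichletSolution lam g (D g)) ∧
      (∀ g, R g = D g - (inner ℂ v g / (weyl q lam - a)) • u) ∧ IsResolventAt (H q a) lam R := by
  obtain ⟨D, hD⟩ := exists_dirichletResolvent h
  have hne := sub_ne_zero.2 hWa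
  let R : L2 →L[ℂ] L2 :=
    D - (((weyl q lam - a)⁻¹ • innerSL ℂ v : L2 →L[ℂ] ℂ)).smulRight u
  have hR : ∀ g, R g = D g - (inner ℂ v g / (weyl q lam - a)) • u := by
    intro g
    simp [R, div_eq_inv_mul]
  have hmem : ∀ g, (R g, g + lam • R g) ∈ deltaGraph q a := by
    intro g
    obtain ⟨u', dR, dL, hus, hW⟩ := id hu
    obtain ⟨v', vR, vL, hvs, -⟩ := id hv
    obtain ⟨d', eR, eL, hd⟩ := hD g
    -- Green's identity for `d = D g` and `v` evaluates the derivative jump of `d` as `(v, g) + (q,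
    -- d)`. Hence `d - s u` satisfies the boundary condition of `H_a` exactly when `s (W - a) = (v,
    -- g)`.
    have hg := hd.green hvs
    rw [inner_sub_right, inner_add_left, inner_smul_right, inner_smul_left, map_one, map_neg,
      Complex.conj_conj] at hg
    have hs := hd.add (hus.smul (-(inner ℂ v g / (weyl q lam - a))))
    have hs' : inner ℂ v g = inner ℂ v g / (weyl q lam - a) * (weyl q lam - a) :=
      (div_mul_cancel₀ _ hne).symm
    rw [hR]
    set s := inner ℂ v g / (weyl q lam - a)
    have e : D g - s • u = D g + (-s) • u := by module
    rw [e]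
    refine ⟨_, _, _, _, _, _, hs, by ring, ?_, ?_⟩
    · rw [inner_add_right, inner_smul_right]
      linear_combination hg - s * hW + hs'
    · simp only
      module
  refine ⟨D, R, hD, hR, fun g => ?_, fun x => ?_⟩
  · obtain ⟨hdom, e⟩ := mem_deltaGraph_iff.1 (hmem g)
    exact ⟨hdom, by rw [e, add_sub_cancel_right]⟩
  · have hx : ((x : L2), H q a x) ∈ deltaGraph q a := mem_deltaGraph_iff.2 ⟨x.2, rfl⟩
    set y := H q a x - lam • (x : L2) with hy
    have hsub := (deltaGraph q a).sub_mem (hmem y) hx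
    -- `R y` and `x` have the same image under `H_a - lam`, so their difference would be an
    -- eigenvector.
    refine sub_eq_zero.1 (eq_zero_of_eigenvector h hu hWa ?_)
    convert hsub using 1
    rw [Prod.mk_sub_mk, hy]
    congr 1
    module

/-! ### Growth of the resolvent and spectral singularities -/

/-- Krein's formula is tested on `g = v`. There the rank-one term has norm `‖v‖³ / |W - a|`, because
`‖u‖ = ‖v‖`; moreover `|Im lam| ‖v‖² = |Im W|`, and the Dirichlet part costs only the summand `1`.
-/
theorem exists_resolvent_norm_ge (q : L2) {a lam : ℂ} (h : lam.im ≠ 0) (hWa : weyl q lam ≠ a) :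
    ∃ R : L2 →L[ℂ] L2, IsResolventAt (H q a) lam R ∧
      |(weyl q lam).im| ≤ (|lam.im| * ‖R‖ + 1) * ‖weyl q lam - a‖ := by
  have hs := neg_mem_slitPlane_of_im_ne_zero h
  obtain ⟨u, hu⟩ := exists_isWeylSolution q hs
  obtain ⟨v, hv⟩ := exists_isWeylSolution q (neg_conj_mem_slitPlane hs)
  obtain ⟨D, R, hD, hR, hres⟩ := exists_resolvent q hs hu hv hWa
  refine ⟨R, hres, ?_⟩
  have hn : 0 < ‖weyl q lam - a‖ := norm_pos_iff.2 (sub_ne_zero.2 hWa)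
  have hi : 0 < |lam.im| := abs_pos.2 h
  have hvpos : 0 < ‖v‖ := norm_pos_iff.2 hv.ne_zero
  have hu2 := hu.im_mul_norm_sq
  have hv2 := hv.im_mul_norm_sq
  rw [weyl_conj q hs, Complex.conj_im, Complex.conj_im] at hv2
  have huv : ‖u‖ = ‖v‖ := by
    refine (sq_eq_sq₀ (norm_nonneg _) (norm_nonneg _)).1 (mul_left_cancel₀ h ?_)
    linarith
  have him : |lam.im| * ‖v‖ ^ 2 = |(weyl q lam).im| := by
    rw [← hu2, huv, abs_mul, abs_of_nonneg (by positivity : 0 ≤ ‖v‖ ^ 2)]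
  have hDv : |lam.im| * ‖D v‖ ≤ ‖v‖ :=
    (mul_le_mul_of_nonneg_right (le_max_left _ _) (norm_nonneg _)).trans (hD v).norm_le
  have hnorm : ‖(inner ℂ v v / (weyl q lam - a)) • u‖ * ‖weyl q lam - a‖ = ‖v‖ ^ 2 * ‖v‖ := by
    rw [norm_smul, norm_div, huv, inner_self_eq_norm_sq_to_K]
    simp only [norm_pow, RCLike.norm_ofReal, abs_norm]
    field_simp
  have hle : ‖(inner ℂ v v / (weyl q lam - a)) • u‖ ≤ ‖D v‖ + ‖R‖ * ‖v‖ := by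
    have e : (inner ℂ v v / (weyl q lam - a)) • u = D v - R v := by rw [hR]; abel
    rw [e]
    exact (norm_sub_le _ _).trans (add_le_add_right (R.le_opNorm v) _)
  refine le_of_mul_le_mul_right ?_ hvpos
  calc |(weyl q lam).im| * ‖v‖
      = |lam.im| * (‖(inner ℂ v v / (weyl q lam - a)) • u‖ * ‖weyl q lam - a‖) := by
        rw [hnorm, ← him]; ring
    _ ≤ |lam.im| * ((‖D v‖ + ‖R‖ * ‖v‖) * ‖weyl q lam - a‖) := by gcongr
    _ = (|lam.im| * ‖D v‖ + |lam.im| * ‖R‖ * ‖v‖) * ‖weyl q lam - a‖ := by ring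
    _ ≤ (‖v‖ + |lam.im| * ‖R‖ * ‖v‖) * ‖weyl q lam - a‖ := by gcongr
    _ = (|lam.im| * ‖R‖ + 1) * ‖weyl q lam - a‖ * ‖v‖ := by ring

/-- Krein's formula requires `W ≠ a`. Each point is moved by less than `1/(n+1)`, and by continuity
of `W` its value by less than `1/(n+1)`, so both limits survive. -/
theorem exists_seq_weyl_ne (q : L2) {lam₀ a : ℂ} {lam : ℕ → ℂ} (hlam_im : ∀ n, (lam n).im ≠ 0)
    (hlam : Tendsto lam atTop (𝓝 lam₀)) (ha : a.im ≠ 0)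
    (hW : Tendsto (fun n => weyl q (lam n)) atTop (𝓝 a)) :
    ∃ mu : ℕ → ℂ, (∀ n, (mu n).im ≠ 0) ∧ (∀ n, weyl q (mu n) ≠ a) ∧
      Tendsto mu atTop (𝓝 lam₀) ∧ Tendsto (fun n => weyl q (mu n)) atTop (𝓝 a) := by
  have hex : ∀ n : ℕ, ∃ z : ℂ, weyl q z ≠ a ∧ z.im ≠ 0 ∧ dist (lam n) z < 1 / ((n : ℝ) + 1) ∧
      dist (weyl q (lam n)) (weyl q z) < 1 / ((n : ℝ) + 1) := by
    intro n
    have hs := neg_mem_slitPlane_of_im_ne_zero (hlam_im n)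
    have hpos : (0 : ℝ) < 1 / ((n : ℝ) + 1) := Nat.one_div_pos_of_nat
    have h1 : ∀ᶠ z in 𝓝 (lam n), z.im ≠ 0 :=
      Complex.continuous_im.continuousAt.eventually_ne (hlam_im n)
    have h2 : ∀ᶠ z in 𝓝 (lam n), dist z (lam n) < 1 / ((n : ℝ) + 1) :=
      Metric.eventually_nhds_iff.2 ⟨_, hpos, fun _ h => h⟩
    have h3 : ∀ᶠ z in 𝓝 (lam n), dist (weyl q z) (weyl q (lam n)) < 1 / ((n : ℝ) + 1) :=
      Metric.tendsto_nhds.1 (hasDerivAt_weyl q hs).choose_spec.continuousAt _ hpos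
    obtain ⟨z, hz, h1, h2, h3⟩ :=
      ((frequently_weyl_ne q hs ha).and_eventually (h1.and (h2.and h3))).exists
    exact ⟨z, hz, h1, by rwa [dist_comm], by rwa [dist_comm]⟩
  choose mu h1 h2 h3 h4 using hex
  have hz := tendsto_one_div_add_atTop_nhds_zero_nat (𝕜 := ℝ)
  exact ⟨mu, h2, h1,
    (tendsto_iff_of_dist (squeeze_zero (fun _ => dist_nonneg) (fun n => (h3 n).le) hz)).1 hlam,
    (tendsto_iff_of_dist (squeeze_zero (fun _ => dist_nonneg) (fun n => (h4 n).le) hz)).1 hW⟩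

theorem isSpectralSingularity_H (q : L2) {lam₀ : ℝ} (hlam₀ : 0 < lam₀) {lam : ℕ → ℂ}
    (hlam_im : ∀ n, (lam n).im ≠ 0) (hlam : Tendsto lam atTop (𝓝 (lam₀ : ℂ))) {a : ℂ}
    (ha : a.im ≠ 0) (hW : Tendsto (fun n => weyl q (lam n)) atTop (𝓝 a)) :
    IsSpectralSingularity (H q a) lam₀ := by
  obtain ⟨mu, him, hne, hmu, hWmu⟩ := exists_seq_weyl_ne q hlam_im hlam ha hW
  refine ⟨hlam₀, ?_⟩
  by_contra! hcon
  choose R hR hge using fun n => exists_resolvent_norm_ge q (him n) (hne n)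
  -- If every `f` satisfied the estimate, the operators `|Im mu_n| R_n` would be pointwise bounded,
  -- hence bounded in norm by some `C`. Then `|Im W(mu_n)| ≤ (C + 1) |W(mu_n) - a|`, and the limit
  -- forces `Im a = 0`.
  obtain ⟨C, hC⟩ := banach_steinhaus (g := fun n => ((|(mu n).im| : ℝ) : ℂ) • R n) (by
    intro f
    obtain ⟨C, ε, hε, hb⟩ := hcon f
    have hev : ∀ᶠ n in atTop, ‖(((|(mu n).im| : ℝ) : ℂ) • R n) f‖ ≤ C * ‖f‖ := by
      filter_upwards [Metric.tendsto_nhds.1 hmu ε hε] with n hn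
      have hpos : 0 < |(mu n).im| := abs_pos.2 (him n)
      have := hb (mu n) (R n) (him n) (by rwa [← dist_eq_norm]) (hR n)
      rw [_root_.smul_apply, norm_smul, Complex.norm_real, norm_abs_eq_norm,
        Real.norm_eq_abs]
      rw [div_mul_eq_mul_div, le_div_iff₀' hpos] at this
      exact this
    -- The estimate holds only near `lam₀`, that is, for large `n`; the finitely many remaining
    -- terms are absorbed into `M`.
    obtain ⟨M, hM⟩ := (isBoundedUnder_of_eventually_le hev).bddAbove_range
    exact ⟨M, fun n => hM ⟨n, rfl⟩⟩)
  have hle : ∀ n, |(weyl q (mu n)).im| ≤ (C + 1) * ‖weyl q (mu n) - a‖ := by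
    intro n
    refine (hge n).trans (mul_le_mul_of_nonneg_right ?_ (norm_nonneg _))
    have := hC n
    rw [norm_smul, Complex.norm_real, norm_abs_eq_norm, Real.norm_eq_abs] at this
    linarith
  have hl := ((Complex.continuous_im.tendsto a).comp hWmu).abs
  have hr := (tendsto_iff_norm_sub_tendsto_zero.1 hWmu).const_mul (C + 1)
  have := le_of_tendsto_of_tendsto' hl hr hle
  rw [mul_zero] at this
  exact ha (abs_nonpos_iff.1 this)

/-! ### Failure of self-adjointness and the theorem -/

/-- Symmetry makes `(R f, A R f)` real, so `Im (R f, f) = -Im lam ‖R f‖²`, and Cauchy–Schwarz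
finishes. -/
theorem norm_resolvent_le_of_isSelfAdjoint {A : L2 →ₗ.[ℂ] L2} (hA : IsSelfAdjoint A) {lam : ℂ}
    {R : L2 →L[ℂ] L2} (hR : IsResolventAt A lam R) (f : L2) : |lam.im| * ‖R f‖ ≤ ‖f‖ := by
  have hform := LinearPMap.adjoint_isFormalAdjoint hA.dense_domain
  rw [LinearPMap.isSelfAdjoint_def.1 hA] at hform
  obtain ⟨hdom, he⟩ := hR.1 f
  have hsym := hform ⟨R f, hdom⟩ ⟨R f, hdom⟩
  rw [sub_eq_iff_eq_add.1 he] at hsym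
  simp only [inner_add_left, inner_add_right, inner_smul_left, inner_smul_right] at hsym
  have h2 : inner ℂ (R f) f - conj (inner ℂ (R f) f) =
      -((lam - conj lam) * ((‖R f‖ ^ 2 : ℝ) : ℂ)) := by
    rw [inner_self_eq_norm_sq_to_K] at hsym
    rw [inner_conj_symm]
    push_cast
    linear_combination -hsym
  have h3 : (inner ℂ (R f) f).im = -(lam.im * ‖R f‖ ^ 2) := by
    rw [Complex.sub_conj, Complex.sub_conj] at h2
    have := congrArg Complex.im h2
    simp [-Complex.ofReal_pow] at this
    linarith
  have h4 := (Complex.abs_im_le_norm _).trans (norm_inner_le_norm (𝕜 := ℂ) (R f) f)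
  rw [h3, abs_neg, abs_mul, abs_of_nonneg (by positivity : 0 ≤ ‖R f‖ ^ 2)] at h4
  rcases (norm_nonneg (R f)).eq_or_lt with h0 | h0
  · rw [← h0, mul_zero]; exact norm_nonneg f
  · refine le_of_mul_le_mul_left ?_ h0
    linarith

theorem IsSpectralSingularity.not_isSelfAdjoint {A : L2 →ₗ.[ℂ] L2} {lam₀ : ℝ}
    (h : IsSpectralSingularity A lam₀) : ¬ IsSelfAdjoint A := by
  intro hA
  obtain ⟨-, f, hf⟩ := h
  obtain ⟨lam, R, him, -, hR, hlt⟩ := hf 1 1 one_pos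
  have := norm_resolvent_le_of_isSelfAdjoint hA hR f
  rw [div_mul_eq_mul_div, one_mul, div_lt_iff₀' (abs_pos.2 him)] at hlt
  linarith

end NonlocalDelta

theorem theorem4p5 (q : NonlocalDelta.L2) (lam₀ : ℝ) (hlam₀ : 0 < lam₀)
    (lam : ℕ → ℂ) (hlam_im : ∀ n, (lam n).im ≠ 0)
    (hlam : Tendsto lam atTop (𝓝 (lam₀ : ℂ)))
    (a : ℂ) (ha : a.im ≠ 0)
    (hW : Tendsto (fun n => NonlocalDelta.weyl q (lam n)) atTop (𝓝 a)) :
    (¬ IsSelfAdjoint (NonlocalDelta.H q a) ∧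
      NonlocalDelta.IsSpectralSingularity (NonlocalDelta.H q a) lam₀) ∧
    (¬ IsSelfAdjoint (NonlocalDelta.H q (conj a)) ∧
      NonlocalDelta.IsSpectralSingularity (NonlocalDelta.H q (conj a)) lam₀) := by
  have h1 := NonlocalDelta.isSpectralSingularity_H q hlam₀ hlam_im hlam ha hW
  have h2 : NonlocalDelta.IsSpectralSingularity (NonlocalDelta.H q (conj a)) lam₀ := by
    -- The conjugate sequence also tends to the real number `lam₀`, and along it `W` tends to `conj
    -- a` by the symmetry of `W`.
    refine NonlocalDelta.isSpectralSingularity_H q hlam₀ (lam := fun n => conj (lam n))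
      (fun n => by simpa using hlam_im n) ?_ (by simpa using ha) ?_
    · have := (Complex.continuous_conj.tendsto _).comp hlam
      rwa [Complex.conj_ofReal] at this
    · refine ((Complex.continuous_conj.tendsto _).comp hW).congr fun n => ?_
      exact (NonlocalDelta.weyl_conj q
        (NonlocalDelta.neg_mem_slitPlane_of_im_ne_zero (hlam_im n))).symm
  exact ⟨⟨h1.not_isSelfAdjoint, h1⟩, ⟨h2.not_isSelfAdjoint, h2⟩⟩
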